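/- Let $d,k\ge 1$ be integers, $0<\alpha\le 1$, $K>0$, $\Omega=[0,1]^d$, $U=(0,1)^d$, and let $\lambda$ be Lebesgue measure on $\Omega$. For a normed space $F$, $C^{k,\alpha}(\Omega,F)$ is the space of functions $f$ on $\Omega$ that are $C^k$ up to the boundary and have finite norm $$\|f\|_{C^{k,\alpha}}=\max_{n\le k}\sup_{x\in U}|D^nf(x)|+\sup_{x\ne y\in U}\frac{|D^kf(x)-D^kf(y)|}{|x-y|^\alpha},$$ where $|D^nf(x)|$ is the operator norm with respect to the Euclidean norm. Let $\mathscr H_{G,K}$ (generators) be the set of bijections $\varphi:\Omega\to\Omega$ with $\varphi\in C^{k,\alpha}(\Omega,\mathbb R^d)$, $\|\varphi\|_{C^{k,\alpha}}\le K$ and $|J_\varphi|\ge 1/K$ on $\Omega$, where $J_\varphi$ is the Jacobian determinant. For such $\varphi$ let $\mu_\varphi=\varphi_*\lambda$ and let $f_\varphi=|J_{\varphi^{-1}}|$ be its density. Let $\mathscr H_{D,K}=\{f_\varphi/(f_\varphi+f_{\varphi'}):\varphi,\varphi'\in\mathscr H_{G,K}\}$ (discriminators). Let $\mu$ be a probability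 measure on $\Omega$ with a density $f_\mu\in C^{k,\alpha}(\Omega,\mathbb R)$ with respect to $\lambda$ that is positive on $\Omega$. Let $\psi:\Omega\to\Omega$, $$\psi(y)=\bigl(F_{Y_1}(y_1),F_{Y_2|Y_1}(y_2|y_1),\dots,F_{Y_d|(Y_1,\dots,Y_{d-1})}(y_d|y_1,\dots,y_{d-1})\bigr),$$ be the Rosenblatt transformation, formed with the conditional distribution functions of a random vector with law $\mu$, and assume that $K$ is so large that $\psi^{-1}\in\mathscr H_{G,K}$. Let $Y_1,Y_2,\dots$ be i.i.d. with law $\mu$ and let $Z_1,Z_2,\dots$ be i.i.d. with law $\lambda$, on one probability space. Put $$L(\varphi,D)=\tfrac12\Bigl(\int\log D\,d\mu+\int\log(1-D)\,d\mu_\varphi\Bigr),\qquad \hat L(\varphi,D,n)=\frac1{2n}\sum_{i=1}^n\log D(Y_i)+\frac1{2n}\sum_{i=1}^n\log\bigl[1-D(\varphi(Z_i))\bigr].$$ Let $$d_{JS}(f,g)=\tfrac12\int_\Omega\Bigl(f\log\tfrac{2f}{f+g}+g\log\tfrac{2g}{f+g}\Bigr)d\lambda$$ be the Jensen--Shannon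 divergence of densities; correspondingly, for probability measures, $d_{JS}(\mu,\nu)=\tfrac12\bigl[d_{KL}(\mu\|\tfrac{\mu+\nu}2)+d_{KL}(\nu\|\tfrac{\mu+\nu}2)\bigr]$. Then: (1) If $\varphi^*\in\mathscr H_{G,K}$ minimizes $\varphi\mapsto\sup_{D\in\mathscr H_{D,K}}L(\varphi,D)$ over $\mathscr H_{G,K}$, then $f_{\varphi^*}=f_\mu$ on $\Omega$. (2) Almost surely the following holds: whenever, for every $n\ge1$, $\hat\varphi_n\in\mathscr H_{G,K}$ minimizes $\varphi\mapsto\sup_{D\in\mathscr H_{D,K}}\hat L(\varphi,D,n)$ over $\mathscr H_{G,K}$, one has $d_{JS}(f_\mu,f_{\hat\varphi_n})\to0$ and $d_{JS}(\mu,\mu_{\hat\varphi_n})\to0$ as $n\to\infty$. -/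

import Mathlib

open MeasureTheory ProbabilityTheory Filter Topology
open scoped ENNReal

noncomputable section

namespace GAN

/-- `ℝᵈ` with the Euclidean norm. -/
abbrev E (d : ℕ) : Type := EuclideanSpace ℝ (Fin d)

/-- The closed unit cube `Ω = [0,1]ᵈ`. -/
def cube (d : ℕ) : Set (E d) := {x | ∀ i, x i ∈ Set.Icc (0 : ℝ) 1}

/-- The open unit cube `U = (0,1)ᵈ`. -/
def openCube (d : ℕ) : Set (E d) := {x | ∀ i, x i ∈ Set.Ioo (0 : ℝ) 1}

/-- Lebesgue measure `λ` on `Ω`, as a measure on `ℝᵈ` carried by `Ω`. -/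
def cubeMeasure (d : ℕ) : Measure (E d) := volume.restrict (cube d)

/-! ### Hölder spaces on the cube

Functions on `Ω` are represented by functions on `ℝᵈ`, of which only the values on `Ω` matter. -/

/-- The norm of `C^{k,α}(Ω, F)`: the maximum over `n ≤ k` of the supremum over `U` of `|Dⁿ f|`, plus
the `α`-Hölder seminorm of `Dᵏ f` on `U`. Here `|Dⁿ f|` is the operator norm of the `n`-th derivative
(a multilinear map). At points of the open cube `U`, the derivative within `Ω` is the ordinary
derivative. -/
def holderNorm {d : ℕ} {F : Type*} [NormedAddCommGroup F] [NormedSpace ℝ F]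
    (k : ℕ) (α : ℝ) (f : E d → F) : ℝ≥0∞ :=
  (⨆ (n : ℕ) (_ : n ≤ k) (x ∈ openCube d), ‖iteratedFDerivWithin ℝ n f (cube d) x‖ₑ) +
    ⨆ (x ∈ openCube d) (y ∈ openCube d) (_ : x ≠ y),
      ‖iteratedFDerivWithin ℝ k f (cube d) x - iteratedFDerivWithin ℝ k f (cube d) y‖ₑ /
        (edist x y) ^ α

/-- `f ∈ C^{k,α}(Ω, F)`. The first component says that `f` is `Cᵏ` up to the boundary of `Ω`: since
`Ω` is the closure of the open convex set `U`, this amounts to `f` being `Cᵏ` on `U` with `f` and all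
its derivatives of order at most `k` extending continuously to `Ω`. -/
def MemHolder {d : ℕ} {F : Type*} [NormedAddCommGroup F] [NormedSpace ℝ F]
    (k : ℕ) (α : ℝ) (f : E d → F) : Prop :=
  ContDiffOn ℝ k f (cube d) ∧ holderNorm k α f < ∞

/-! ### Generators and discriminators -/

/-- The Jacobian determinant on `Ω` (up to the boundary) of a map `Ω → ℝᵈ`. -/
def jacobian {d : ℕ} (φ : E d → E d) (x : E d) : ℝ := (fderivWithin ℝ φ (cube d) x).det

/-- The hypothesis space of generators `H_{G,K}`. -/
def generators (d k : ℕ) (α K : ℝ) : Set (E d → E d) :=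
  {φ | MemHolder k α φ ∧ Set.BijOn φ (cube d) (cube d) ∧
    holderNorm k α φ ≤ ENNReal.ofReal K ∧ ∀ x ∈ cube d, 1 / K ≤ |jacobian φ x|}

/-- The generated measure `μ_φ = φ_* λ`. -/
def genMeasure {d : ℕ} (φ : E d → E d) : Measure (E d) := (cubeMeasure d).map φ

/-- The density `f_φ = |J_{φ⁻¹}|` of the generated measure, as a function on `Ω`. -/
def genDensity {d : ℕ} (φ : E d → E d) (y : E d) : ℝ :=
  |jacobian (Function.invFunOn φ (cube d)) y|

/-- The discriminator `D_{φ,φ'} = f_φ / (f_φ + f_φ')`. -/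
def discriminator {d : ℕ} (φ φ' : E d → E d) (x : E d) : ℝ :=
  genDensity φ x / (genDensity φ x + genDensity φ' x)

/-- The hypothesis space of discriminators `H_{D,K}`. -/
def discriminators (d k : ℕ) (α K : ℝ) : Set (E d → ℝ) :=
  {D | ∃ φ ∈ generators d k α K, ∃ φ' ∈ generators d k α K, D = discriminator φ φ'}

/-! ### Loss functions -/

/-- The theoretical loss
`L(φ, D) = 1/2 (E_{Y ∼ μ} [log D(Y)] + E_{Ŷ ∼ μ_φ} [log (1 - D(Ŷ))])`. -/
def loss {d : ℕ} (μ : Measure (E d)) (φ : E d → E d) (D : E d → ℝ) : ℝ :=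
  (1 / 2) * ((∫ y, Real.log (D y) ∂μ) + ∫ y, Real.log (1 - D y) ∂(genMeasure φ))

/-- The empirical loss `L̂(φ, D, n)` for the first `n` points of the samples `y` and `z`. -/
def empLoss {d : ℕ} (y z : ℕ → E d) (φ : E d → E d) (D : E d → ℝ) (n : ℕ) : ℝ :=
  (1 / (2 * n)) * (∑ i ∈ Finset.range n, Real.log (D (y i))) +
    (1 / (2 * n)) * ∑ i ∈ Finset.range n, Real.log (1 - D (φ (z i)))

/-- `sup_{D ∈ H_{D,K}} L(φ, D)`. -/
def maxLoss {d : ℕ} (k : ℕ) (α K : ℝ) (μ : Measure (E d)) (φ : E d → E d) : ℝ :=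
  ⨆ D : discriminators d k α K, loss μ φ D

/-- `sup_{D ∈ H_{D,K}} L̂(φ, D, n)`. -/
def maxEmpLoss {d : ℕ} (k : ℕ) (α K : ℝ) (y z : ℕ → E d) (n : ℕ) (φ : E d → E d) : ℝ :=
  ⨆ D : discriminators d k α K, empLoss y z φ D n

/-! ### Jensen-Shannon divergence -/

/-- The Jensen-Shannon divergence of two measures. -/
def jsDiv {X : Type*} [MeasurableSpace X] (μ ν : Measure X) : ℝ≥0∞ :=
  2⁻¹ * (InformationTheory.klDiv μ ((2⁻¹ : ℝ≥0∞) • (μ + ν)) +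
    InformationTheory.klDiv ν ((2⁻¹ : ℝ≥0∞) • (μ + ν)))

/-- The Kullback-Leibler divergence of two densities with respect to `η`. -/
def klDivDensity {X : Type*} [MeasurableSpace X] (η : Measure X) (m n : X → ℝ) : ℝ :=
  ∫ x, m x * Real.log (m x / n x) ∂η

/-- The Jensen-Shannon divergence of two densities with respect to `η`. -/
def jsDivDensity {X : Type*} [MeasurableSpace X] (η : Measure X) (m n : X → ℝ) : ℝ :=
  (1 / 2) * (klDivDensity η m (fun x => (m x + n x) / 2) +
    klDivDensity η n (fun x => (m x + n x) / 2))

/-! ### The Rosenblatt transformation -/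

/-- For a random vector `Y` on `Ω` with density `f` (extended by `0` outside `Ω`), the density of the
first `m` coordinates `(Y₁, …, Y_m)` at `(y₁, …, y_m)`: the remaining coordinates are integrated out
over `ℝ^{d-m}`. -/
def marginalDensity {d : ℕ} (f : E d → ℝ) (m : ℕ) (y : Fin d → ℝ) : ℝ :=
  (lmarginal (fun _ : Fin d => (volume : Measure ℝ))
    (Finset.univ.filter fun i : Fin d => m ≤ i.val)
    (fun z => ENNReal.ofReal ((cube d).indicator f (WithLp.toLp 2 z))) y).toReal

/-- The conditional density at `s` of the coordinate with (zero-based) index `j` given that the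
coordinates of smaller index equal those of `y`; it is `0` where the marginal density of the latter
vanishes. For `j = 0` the denominator is the total mass. -/
def condDensity {d : ℕ} (f : E d → ℝ) (j : Fin d) (y : Fin d → ℝ) (s : ℝ) : ℝ :=
  marginalDensity f (j.val + 1) (Function.update y j s) / marginalDensity f j.val y

/-- The Rosenblatt transformation
`ψ(y) = (F_{Y₁}(y₁), F_{Y₂|Y₁}(y₂|y₁), …, F_{Y_d|Y₁,…,Y_{d-1}}(y_d|y₁,…,y_{d-1}))`. -/
def rosenblatt {d : ℕ} (f : E d → ℝ) (y : E d) : E d :=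
  WithLp.toLp 2 fun j => ∫ s in Set.Iic (y j), condDensity f j (WithLp.ofLp y) s

/-- The inverse on `Ω` of the Rosenblatt transformation. -/
def invRosenblatt {d : ℕ} (f : E d → ℝ) : E d → E d :=
  Function.invFunOn (rosenblatt f) (cube d)

end GAN

end

/-! Write `φ₀` for the inverse Rosenblatt map. The Rosenblatt map has a triangular derivative whose
diagonal entries are ratios of successive marginal densities of `μ`; their product telescopes to
`fμ`, so `φ₀` generates exactly `μ` (`genDensity_invRosenblatt`). Hence for every generator `φ` the
class of discriminators contains `D_{φ₀,φ} = fμ / (fμ + f_φ)`, at which the loss equals `d_JS(fμ,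
f_φ) - log 2` (`loss_discriminator_eq`). Against `φ₀` itself no discriminator exceeds `-log 2`,
because `t (1 - t) ≤ 1/4` (`loss_le_of_genDensity_eq`). A minimizer of the maximal loss therefore
has divergence at most `0`, which forces equality of the two continuous densities.

For the empirical minimizers the same comparison is made up to sampling error. If `L̂` and `L`
differ by at most `ε` uniformly in generator and discriminator, then `d_JS(fμ, f_φ̂) - log 2 = L(φ̂,
D_{φ₀,φ̂}) ≤ sup_D L̂(φ̂, D) + ε ≤ sup_D L̂(φ₀, D) + ε ≤ -log 2 + 2ε`.

Uniformity comes from Arzelà-Ascoli and the strong law on finite nets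
(`IsEquiFamily.uniform_strong_law`). The equicontinuity it needs is quantitative: `f_φ = |det Dφ ∘
φ⁻¹|⁻¹`, where the derivatives lie in one compact set of invertible matrices and share a modulus of
continuity, and the inverses are uniformly Lipschitz (`pullbackFDeriv_equicontinuous`). No
closedness or compactness of the set of generators itself is required. -/

noncomputable section

namespace GAN

/-! ### Geometry of the cube -/

section Cube

variable {d : ℕ}

lemma openCube_subset_cube : openCube d ⊆ cube d := fun _ hx i => Set.Ioo_subset_Icc_self (hx i)

lemma isOpen_openCube : IsOpen (openCube d) := by
  have : openCube d = ⋂ i, (fun x : E d => x i) ⁻¹' Set.Ioo (0 : ℝ) 1 := by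
    ext x; simp [openCube]
  rw [this]
  exact isOpen_iInter_of_finite fun i => isOpen_Ioo.preimage (by fun_prop)

lemma isClosed_cube : IsClosed (cube d) := by
  have : cube d = ⋂ i, (fun x : E d => x i) ⁻¹' Set.Icc (0 : ℝ) 1 := by
    ext x; simp [cube]
  rw [this]
  exact isClosed_iInter fun i => isClosed_Icc.preimage (by fun_prop)

lemma measurableSet_cube : MeasurableSet (cube d) := isClosed_cube.measurableSet

lemma isCompact_cube : IsCompact (cube d) := by
  have h : IsCompact (Set.univ.pi fun _ : Fin d => Set.Icc (0 : ℝ) 1) :=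
    isCompact_univ_pi fun _ => isCompact_Icc
  convert! h.image (PiLp.continuous_toLp 2 (fun _ : Fin d => ℝ)) using 1
  ext x
  constructor
  · intro hx
    exact ⟨WithLp.ofLp x, fun i _ => hx i, rfl⟩
  · rintro ⟨y, hy, rfl⟩ i
    exact hy i (Set.mem_univ i)

lemma convex_openCube : Convex ℝ (openCube d) := by
  intro x hx y hy a b ha hb hab i
  exact convex_Ioo 0 1 (hx i) (hy i) ha hb hab

lemma convex_cube : Convex ℝ (cube d) := by
  intro x hx y hy a b ha hb hab i
  exact convex_Icc 0 1 (hx i) (hy i) ha hb hab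

lemma cube_subset_closure_openCube : cube d ⊆ closure (openCube d) := by
  intro x hx
  let c : E d := WithLp.toLp 2 fun _ => 1 / 2
  have ht : Tendsto (fun t : ℝ => (1 - t) • x + t • c) (𝓝[>] 0) (𝓝 x) := by
    have : Tendsto (fun t : ℝ => (1 - t) • x + t • c) (𝓝 0) (𝓝 ((1 - (0 : ℝ)) • x + (0 : ℝ) • c)) :=
      Continuous.tendsto (by fun_prop) 0
    simpa using this.mono_left nhdsWithin_le_nhds
  refine mem_closure_of_tendsto ht ?_
  filter_upwards [Ioo_mem_nhdsGT (zero_lt_one (α := ℝ))] with t ht i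
  have h := hx i
  simp only [PiLp.add_apply, PiLp.smul_apply, smul_eq_mul, c]
  constructor
  · nlinarith [h.1, ht.1, ht.2, mul_nonneg (sub_nonneg.2 ht.2.le) h.1]
  · nlinarith [h.2, ht.1, ht.2, mul_nonneg (sub_nonneg.2 ht.2.le) (sub_nonneg.2 h.2)]

lemma openCube_nonempty : (openCube d).Nonempty :=
  ⟨WithLp.toLp 2 fun _ => 1 / 2, fun _ => by norm_num⟩

lemma cube_nonempty : (cube d).Nonempty := openCube_nonempty.mono openCube_subset_cube

lemma cube_mem_nhds {x : E d} (hx : x ∈ openCube d) : cube d ∈ 𝓝 x :=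
  mem_of_superset (isOpen_openCube.mem_nhds hx) openCube_subset_cube

lemma uniqueDiffOn_cube : UniqueDiffOn ℝ (cube d) :=
  uniqueDiffOn_convex convex_cube <| openCube_nonempty.mono <|
    interior_maximal openCube_subset_cube isOpen_openCube

lemma volume_cube_diff_openCube : volume (cube d \ openCube d) = 0 := by
  refine measure_mono_null ?_ ((convex_openCube (d := d)).addHaar_frontier volume)
  rw [frontier, isOpen_openCube.interior_eq]
  exact Set.sdiff_subset_sdiff_left cube_subset_closure_openCube

lemma ae_mem_openCube : ∀ᵐ x ∂cubeMeasure d, x ∈ openCube d := by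
  rw [cubeMeasure, ae_restrict_iff' measurableSet_cube, ae_iff]
  convert! volume_cube_diff_openCube (d := d) using 2
  ext x; simp

lemma ae_mem_cube : ∀ᵐ x ∂cubeMeasure d, x ∈ cube d :=
  ae_mem_openCube.mono fun _ hx => openCube_subset_cube hx

/-- The Hölder norm controls derivatives only on the open cube; density of the open cube carries
such bounds to the boundary. -/
lemma le_on_cube_of_continuousOn {f g : E d → ℝ} (hf : ContinuousOn f (cube d))
    (hg : ContinuousOn g (cube d)) (h : ∀ x ∈ openCube d, f x ≤ g x) {x : E d} (hx : x ∈ cube d) :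
    f x ≤ g x := by
  have : (𝓝[openCube d] x).NeBot := mem_closure_iff_nhdsWithin_neBot.1
      (cube_subset_closure_openCube hx)
  exact le_of_tendsto_of_tendsto ((hf x hx).mono openCube_subset_cube)
    ((hg x hx).mono openCube_subset_cube) (eventually_nhdsWithin_of_forall h)

/-- Integral identities and the Rosenblatt computation give equality of densities only almost
everywhere; continuity upgrades it to every point, boundary included. -/
lemma eqOn_cube_of_ae {f g : E d → ℝ} (hf : ContinuousOn f (cube d))
    (hg : ContinuousOn g (cube d)) (h : ∀ᵐ x ∂cubeMeasure d, f x = g x) :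
    Set.EqOn f g (cube d) := by
  have h0 : (volume.restrict (openCube d)) ≤ cubeMeasure d :=
    Measure.restrict_mono openCube_subset_cube le_rfl
  have h1 : Set.EqOn f g (openCube d) :=
    Measure.eqOn_open_of_ae_eq (ae_mono h0 h) isOpen_openCube
      (hf.mono openCube_subset_cube) (hg.mono openCube_subset_cube)
  intro x hx
  exact le_antisymm (le_on_cube_of_continuousOn hf hg (fun x hx => (h1 hx).le) hx)
    (le_on_cube_of_continuousOn hg hf (fun x hx => (h1 hx).ge) hx)

end Cube

/-! ### Estimates for generators -/

section Generators

variable {d k : ℕ} {α K : ℝ} {φ : E d → E d}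

lemma enorm_iteratedFDerivWithin_le_holderNorm {n : ℕ} (hn : n ≤ k) {x : E d}
    (hx : x ∈ openCube d) :
    ‖iteratedFDerivWithin ℝ n φ (cube d) x‖ₑ ≤ holderNorm k α φ := by
  refine le_trans ?_ (le_add_right le_rfl)
  exact le_iSup₂_of_le n hn (le_iSup₂_of_le (f := fun x (_ : x ∈ openCube d) =>
    ‖iteratedFDerivWithin ℝ n φ (cube d) x‖ₑ) x hx le_rfl)

lemma enorm_sub_div_le_holderNorm {x y : E d} (hx : x ∈ openCube d) (hy : y ∈ openCube d)
    (hxy : x ≠ y) :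
    ‖iteratedFDerivWithin ℝ k φ (cube d) x - iteratedFDerivWithin ℝ k φ (cube d) y‖ₑ /
        (edist x y) ^ α ≤ holderNorm k α φ := by
  refine le_trans ?_ (le_add_left le_rfl)
  exact le_iSup₂_of_le (f := fun x (_ : x ∈ openCube d) => ⨆ (y ∈ openCube d) (_ : x ≠ y),
      ‖iteratedFDerivWithin ℝ k φ (cube d) x - iteratedFDerivWithin ℝ k φ (cube d) y‖ₑ /
        (edist x y) ^ α) x hx
    (le_iSup₂_of_le (f := fun y (_ : y ∈ openCube d) => ⨆ (_ : x ≠ y),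
      ‖iteratedFDerivWithin ℝ k φ (cube d) x - iteratedFDerivWithin ℝ k φ (cube d) y‖ₑ /
        (edist x y) ^ α) y hy (le_iSup_of_le hxy le_rfl))

lemma norm_iteratedFDerivWithin_le (hφ : φ ∈ generators d k α K) (hK : 0 < K) {n : ℕ} (hn : n ≤ k)
    {x : E d}
    (hx : x ∈ openCube d) : ‖iteratedFDerivWithin ℝ n φ (cube d) x‖ ≤ K := by
  have := (enorm_iteratedFDerivWithin_le_holderNorm (α := α) (φ := φ) hn hx).trans hφ.2.2.1
  rwa [← ofReal_norm, ENNReal.ofReal_le_ofReal_iff hK.le] at this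

lemma norm_iteratedFDerivWithin_sub_le (hφ : φ ∈ generators d k α K) (hα : 0 < α) (hK : 0 < K)
    {x y : E d} (hx : x ∈ openCube d)
    (hy : y ∈ openCube d) :
    ‖iteratedFDerivWithin ℝ k φ (cube d) x - iteratedFDerivWithin ℝ k φ (cube d) y‖ ≤
      K * dist x y ^ α := by
  rcases eq_or_ne x y with rfl | hxy
  · simp [Real.zero_rpow hα.ne']
  have h := (enorm_sub_div_le_holderNorm (α := α) (φ := φ) (k := k) hx hy hxy).trans hφ.2.2.1
  have hd : 0 < dist x y := dist_pos.2 hxy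
  rw [edist_dist, ENNReal.ofReal_rpow_of_pos hd, ← ofReal_norm,
    ← ENNReal.ofReal_div_of_pos (by positivity), ENNReal.ofReal_le_ofReal_iff hK.le] at h
  exact (div_le_iff₀ (by positivity)).1 h

lemma generator_contDiffOn (hφ : φ ∈ generators d k α K) (hk : 1 ≤ k) : ContDiffOn ℝ 1 φ (cube d) :=
  hφ.1.1.of_le (by exact_mod_cast hk)

lemma generator_continuousOn_fderivWithin (hφ : φ ∈ generators d k α K) (hk : 1 ≤ k) :
    ContinuousOn (fderivWithin ℝ φ (cube d)) (cube d) :=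
  (generator_contDiffOn hφ hk).continuousOn_fderivWithin uniqueDiffOn_cube le_rfl

lemma generator_differentiableOn (hφ : φ ∈ generators d k α K) (hk : 1 ≤ k) : DifferentiableOn ℝ φ
    (cube d) :=
  (generator_contDiffOn hφ hk).differentiableOn one_ne_zero

lemma generator_continuousOn (hφ : φ ∈ generators d k α K) : ContinuousOn φ (cube d) :=
    hφ.1.1.continuousOn

lemma norm_fderivWithin_sub_le_iterated {x y : E d} (hx : x ∈ cube d) (hy : y ∈ cube d) :
    ‖fderivWithin ℝ φ (cube d) x - fderivWithin ℝ φ (cube d) y‖ ≤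
      ‖iteratedFDerivWithin ℝ 1 φ (cube d) x - iteratedFDerivWithin ℝ 1 φ (cube d) y‖ := by
  refine ContinuousLinearMap.opNorm_le_bound _ (norm_nonneg _) fun v => ?_
  have := (iteratedFDerivWithin ℝ 1 φ (cube d) x -
    iteratedFDerivWithin ℝ 1 φ (cube d) y).le_opNorm (fun _ => v)
  simpa [iteratedFDerivWithin_one_apply (uniqueDiffOn_cube x hx),
    iteratedFDerivWithin_one_apply (uniqueDiffOn_cube y hy)] using this

lemma generator_norm_fderivWithin_le (hφ : φ ∈ generators d k α K) (hk : 1 ≤ k) (hK : 0 < K)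
    {x : E d} (hx : x ∈ cube d) :
    ‖fderivWithin ℝ φ (cube d) x‖ ≤ K := by
  refine le_on_cube_of_continuousOn (generator_continuousOn_fderivWithin hφ hk).norm
    continuousOn_const (fun y hy => ?_) hx
  have h := norm_iteratedFDerivWithin_le hφ hK hk hy
  rwa [norm_iteratedFDerivWithin_one _ (uniqueDiffOn_cube y (openCube_subset_cube hy))] at h

lemma generator_norm_sub_le (hφ : φ ∈ generators d k α K) (hk : 1 ≤ k) (hK : 0 < K) {x y : E d}
    (hx : x ∈ cube d)
    (hy : y ∈ cube d) : dist (φ x) (φ y) ≤ K * dist x y := by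
  rw [dist_eq_norm, dist_eq_norm]
  exact convex_cube.norm_image_sub_le_of_norm_fderivWithin_le (generator_differentiableOn hφ hk)
    (fun z hz => generator_norm_fderivWithin_le hφ hk hK hz) hy hx

/-- A modulus of continuity of `Dφ` common to all generators. For `k = 1` the Hölder seminorm gives
the first summand; for `k ≥ 2` the bound `K` on the second derivative and the mean value inequality
give the second. Taking the sum covers both cases. The boundary is reached by continuity in one
variable at a time. -/
lemma generator_norm_fderivWithin_sub_le (hφ : φ ∈ generators d k α K) (hk : 1 ≤ k) (hα : 0 < α)
    (hK : 0 < K) {x y : E d}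
    (hx : x ∈ cube d) (hy : y ∈ cube d) :
    dist (fderivWithin ℝ φ (cube d) x) (fderivWithin ℝ φ (cube d) y) ≤
      K * dist x y ^ α + K * dist x y := by
  have key : ∀ x ∈ openCube d, ∀ y ∈ openCube d,
      dist (fderivWithin ℝ φ (cube d) x) (fderivWithin ℝ φ (cube d) y) ≤
      K * dist x y ^ α + K * dist x y := by
    intro x hx y hy
    rw [dist_eq_norm]
    refine (norm_fderivWithin_sub_le_iterated (openCube_subset_cube hx)
      (openCube_subset_cube hy)).trans ?_
    rcases hk.eq_or_lt with rfl | hk2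
    · refine (norm_iteratedFDerivWithin_sub_le hφ hα hK hx hy).trans ?_
      have : 0 ≤ K * dist x y := by positivity
      linarith
    · have h0 : 0 ≤ K * dist x y ^ α := by positivity
      have hdiff : ∀ z ∈ openCube d,
          DifferentiableWithinAt ℝ (iteratedFDerivWithin ℝ 1 φ (cube d)) (cube d) z := fun z hz =>
        hφ.1.1.differentiableOn_iteratedFDerivWithin (by exact_mod_cast hk2) uniqueDiffOn_cube z
          (openCube_subset_cube hz)
      have := convex_openCube.norm_image_sub_le_of_norm_hasFDerivWithin_le (C := K)
        (fun z hz => ((hdiff z hz).hasFDerivWithinAt.mono openCube_subset_cube))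
        (fun z hz => ?_) hy hx
      · rw [← dist_eq_norm x y] at this
        linarith
      · rw [norm_fderivWithin_iteratedFDerivWithin]
        exact norm_iteratedFDerivWithin_le hφ hK hk2 hz
  have hc : ContinuousOn (fderivWithin ℝ φ (cube d)) (cube d) :=
    generator_continuousOn_fderivWithin hφ hk
  have hmod : ∀ y : E d, Continuous fun x : E d => K * dist x y ^ α + K * dist x y := by
    intro y
    have : Continuous fun x : E d => dist x y ^ α :=
      (continuous_id.dist continuous_const).rpow_const fun _ => Or.inr hα.le
    fun_prop
  have step : ∀ x ∈ cube d, ∀ y ∈ openCube d,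
      dist (fderivWithin ℝ φ (cube d) x) (fderivWithin ℝ φ (cube d) y) ≤
      K * dist x y ^ α + K * dist x y := fun x hx y hy =>
    le_on_cube_of_continuousOn
        (f := fun x => dist (fderivWithin ℝ φ (cube d) x) (fderivWithin ℝ φ (cube d) y))
      (continuous_dist.comp_continuousOn (hc.prodMk continuousOn_const)) (hmod y).continuousOn
          (fun x hx => key x hx y hy) hx
  have := le_on_cube_of_continuousOn
    (f := fun y => dist (fderivWithin ℝ φ (cube d) y) (fderivWithin ℝ φ (cube d) x))
    (continuous_dist.comp_continuousOn (hc.prodMk continuousOn_const)) (hmod x).continuousOn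
        (fun y hy => ?_) hy
  · rwa [dist_comm, dist_comm x y]
  · rw [dist_comm, dist_comm y x]
    exact step x hx y hy

end Generators

/-! ### Inverses of generators and their densities -/

section Inverse

variable {d k : ℕ} {α K : ℝ}

/-- The admissible Jacobian matrices of generators. -/
def jacobians (d : ℕ) (K : ℝ) : Set (E d →L[ℝ] E d) := {A | ‖A‖ ≤ K ∧ 1 / K ≤ |A.det|}

lemma isCompact_jacobians : IsCompact (jacobians d K) := by
  have h : jacobians d K = Metric.closedBall 0 K ∩ {A | 1 / K ≤ |A.det|} := by
    ext A; simp [jacobians]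
  rw [h]
  exact (isCompact_closedBall _ _).inter_right
    (isClosed_le continuous_const ContinuousLinearMap.continuous_det.abs)

lemma det_ne_zero_of_mem_jacobians (hK : 0 < K) {A : E d →L[ℝ] E d} (hA : A ∈ jacobians d K) :
    A.det ≠ 0 :=
  abs_pos.1 (lt_of_lt_of_le (by positivity) hA.2)

lemma exists_equiv_of_det_ne_zero {A : E d →L[ℝ] E d} (hA : A.det ≠ 0) :
    ∃ e : E d ≃L[ℝ] E d, (e : E d →L[ℝ] E d) = A :=
  ⟨A.toContinuousLinearEquivOfDetNeZero hA, A.coe_toContinuousLinearEquivOfDetNeZero hA⟩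

/-- Inversion is continuous at invertible operators, hence bounded on the compact set of admissible
Jacobians. -/
lemma exists_norm_inverse_le (d : ℕ) (hK : 0 < K) :
    ∃ C, 0 < C ∧ ∀ e : E d ≃L[ℝ] E d, (e : E d →L[ℝ] E d) ∈ jacobians d K →
      ‖(e.symm : E d →L[ℝ] E d)‖ ≤ C := by
  have hc : ContinuousOn (ContinuousLinearMap.inverse : (E d →L[ℝ] E d) → (E d →L[ℝ] E d))
      (jacobians d K) := by
    intro A hA
    obtain ⟨e, rfl⟩ := exists_equiv_of_det_ne_zero (det_ne_zero_of_mem_jacobians hK hA)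
    exact ((contDiffAt_map_inverse (𝕜 := ℝ) (n := 1) e).continuousAt).continuousWithinAt
  obtain ⟨C, hC⟩ := isCompact_jacobians.exists_bound_of_continuousOn hc
  -- The maximum with `1` only serves to make the constant positive.
  refine ⟨max C 1, by positivity, fun e he => le_max_of_le_left ?_⟩
  simpa using hC _ he

variable {φ : E d → E d}

/-- The inverse on the cube of a map. -/
abbrev cubeInv (φ : E d → E d) : E d → E d := Function.invFunOn φ (cube d)

lemma generator_fderivWithin_mem_jacobians (hφ : φ ∈ generators d k α K) (hk : 1 ≤ k) (hK : 0 < K)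
    {x : E d} (hx : x ∈ cube d) : fderivWithin ℝ φ (cube d) x ∈ jacobians d K :=
  ⟨generator_norm_fderivWithin_le hφ hk hK hx, hφ.2.2.2 x hx⟩

lemma generator_invOn (hφ : φ ∈ generators d k α K) :
    Set.InvOn (cubeInv φ) φ (cube d) (cube d) := hφ.2.1.invOn_invFunOn

lemma cubeInv_bijOn (hφ : φ ∈ generators d k α K) :
    Set.BijOn (cubeInv φ) (cube d) (cube d) :=
  (generator_invOn hφ).symm.bijOn hφ.2.1.surjOn.mapsTo_invFunOn hφ.2.1.mapsTo

lemma cubeInv_mem (hφ : φ ∈ generators d k α K) {y : E d} (hy : y ∈ cube d) :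
    cubeInv φ y ∈ cube d := (cubeInv_bijOn hφ).mapsTo hy

lemma apply_cubeInv (hφ : φ ∈ generators d k α K) {y : E d} (hy : y ∈ cube d) :
    φ (cubeInv φ y) = y := (generator_invOn hφ).2 hy

lemma cubeInv_apply (hφ : φ ∈ generators d k α K) {x : E d} (hx : x ∈ cube d) :
    cubeInv φ (φ x) = x := (generator_invOn hφ).1 hx

/-- The preimage of a closed set `c` under the inverse is the image of the compact set `s ∩ c`,
which is closed in a Hausdorff space. -/
lemma continuousOn_invFunOn_of_isCompact {X Y : Type*} [TopologicalSpace X] [TopologicalSpace Y]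
    [T2Space Y] [Nonempty X] {f : X → Y} {s : Set X} {t : Set Y} (hs : IsCompact s)
    (hf : ContinuousOn f s) (hb : Set.BijOn f s t) : ContinuousOn (Function.invFunOn f s) t := by
  rw [continuousOn_iff_isClosed]
  intro c hc
  refine ⟨f '' (s ∩ c), ((hs.inter_right hc).image_of_continuousOn
    (hf.mono Set.inter_subset_left)).isClosed, ?_⟩
  ext y
  constructor
  · rintro ⟨h1, h2⟩
    exact ⟨⟨_, ⟨hb.surjOn.mapsTo_invFunOn h2, h1⟩, hb.invOn_invFunOn.2 h2⟩, h2⟩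
  · rintro ⟨⟨x, ⟨hx, hxc⟩, rfl⟩, h2⟩
    exact ⟨by simpa [hb.invOn_invFunOn.1 hx] using hxc, h2⟩

lemma cubeInv_continuousOn (hφ : φ ∈ generators d k α K) :
    ContinuousOn (cubeInv φ) (cube d) :=
  continuousOn_invFunOn_of_isCompact isCompact_cube (generator_continuousOn hφ) hφ.2.1

/-- Since the inverse is already known to be continuous, invertibility of the derivative is enough.
The argument is relative to the cube, so it includes boundary points, which the usual inverse
function theorem does not reach. -/
lemma cubeInv_hasFDerivWithinAt (hφ : φ ∈ generators d k α K) (hk : 1 ≤ k) {y : E d}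
    (hy : y ∈ cube d) {e : E d ≃L[ℝ] E d}
    (he : (e : E d →L[ℝ] E d) = fderivWithin ℝ φ (cube d) (cubeInv φ y)) :
    HasFDerivWithinAt (cubeInv φ) (e.symm : E d →L[ℝ] E d) (cube d) y := by
  have h1 := (generator_differentiableOn hφ hk _ (cubeInv_mem hφ hy)).hasFDerivWithinAt
  rw [← he] at h1
  refine h1.of_local_left_inverse ?_ hy ?_
  · exact (cubeInv_continuousOn hφ y hy).tendsto_nhdsWithin (fun z hz => cubeInv_mem hφ hz)
  · exact eventually_nhdsWithin_of_forall fun z hz => apply_cubeInv hφ hz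

lemma exists_equiv_fderivWithin (hφ : φ ∈ generators d k α K) (hk : 1 ≤ k) (hK : 0 < K) {x : E d}
    (hx : x ∈ cube d) :
    ∃ e : E d ≃L[ℝ] E d, (e : E d →L[ℝ] E d) = fderivWithin ℝ φ (cube d) x :=
  exists_equiv_of_det_ne_zero <| det_ne_zero_of_mem_jacobians hK <|
    generator_fderivWithin_mem_jacobians hφ hk hK hx

lemma cubeInv_differentiableOn (hφ : φ ∈ generators d k α K) (hk : 1 ≤ k) (hK : 0 < K) :
    DifferentiableOn ℝ (cubeInv φ) (cube d) := by
  intro y hy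
  obtain ⟨e, he⟩ := exists_equiv_fderivWithin hφ hk hK (cubeInv_mem hφ hy)
  exact (cubeInv_hasFDerivWithinAt hφ hk hy he).differentiableWithinAt

lemma genDensity_eq (hφ : φ ∈ generators d k α K) (hk : 1 ≤ k) (hK : 0 < K) {y : E d}
    (hy : y ∈ cube d) :
    genDensity φ y = |(fderivWithin ℝ φ (cube d) (cubeInv φ y)).det|⁻¹ := by
  obtain ⟨e, he⟩ := exists_equiv_fderivWithin hφ hk hK (cubeInv_mem hφ hy)
  rw [genDensity, jacobian,
    (cubeInv_hasFDerivWithinAt hφ hk hy he).fderivWithin (uniqueDiffOn_cube y hy), ← he, ← abs_inv]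
  congr 1
  exact e.det_coe_symm

/-- Mean value inequality on the convex cube, with the uniform bound on inverse Jacobians; the
constant serves all generators at once. -/
lemma exists_lipschitz_cubeInv (d : ℕ) (α : ℝ) (hk : 1 ≤ k) (hK : 0 < K) :
    ∃ C, 0 < C ∧ ∀ φ ∈ generators d k α K, ∀ x ∈ cube d, ∀ y ∈ cube d,
      dist (cubeInv φ x) (cubeInv φ y) ≤ C * dist x y := by
  obtain ⟨C, hC0, hC⟩ := exists_norm_inverse_le d hK
  refine ⟨C, hC0, fun φ hφ x hx y hy => ?_⟩
  rw [dist_eq_norm, dist_eq_norm]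
  refine convex_cube.norm_image_sub_le_of_norm_fderivWithin_le (cubeInv_differentiableOn hφ hk hK)
    (fun z hz => ?_) hy hx
  obtain ⟨e, he⟩ := exists_equiv_fderivWithin hφ hk hK (cubeInv_mem hφ hz)
  rw [(cubeInv_hasFDerivWithinAt hφ hk hz he).fderivWithin (uniqueDiffOn_cube z hz)]
  exact hC e (he ▸ generator_fderivWithin_mem_jacobians hφ hk hK (cubeInv_mem hφ hz))

/-- The map `y ↦ Dφ(φ⁻¹(y))`, in terms of which the density of `φ_* λ` is expressed. -/
def pullbackFDeriv (φ : E d → E d) (y : E d) : E d →L[ℝ] E d :=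
  fderivWithin ℝ φ (cube d) (cubeInv φ y)

lemma pullbackFDeriv_mem (hφ : φ ∈ generators d k α K) (hk : 1 ≤ k) (hK : 0 < K) {y : E d}
    (hy : y ∈ cube d) : pullbackFDeriv φ y ∈ jacobians d K :=
  generator_fderivWithin_mem_jacobians hφ hk hK (cubeInv_mem hφ hy)

lemma pullbackFDeriv_continuousOn (hφ : φ ∈ generators d k α K) (hk : 1 ≤ k) :
    ContinuousOn (pullbackFDeriv φ) (cube d) :=
  (generator_continuousOn_fderivWithin hφ hk).comp (cubeInv_continuousOn hφ)
    fun _ hy => cubeInv_mem hφ hy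

/-- The common modulus of continuity of the derivatives is composed with the common Lipschitz
constant of the inverses. -/
lemma pullbackFDeriv_equicontinuous (d : ℕ) (hk : 1 ≤ k) (hα : 0 < α) (hK : 0 < K) {ε : ℝ}
    (hε : 0 < ε) : ∃ δ > 0, ∀ φ ∈ generators d k α K, ∀ x ∈ cube d, ∀ y ∈ cube d, dist x y < δ →
      dist (pullbackFDeriv φ x) (pullbackFDeriv φ y) < ε := by
  obtain ⟨C, hC0, hC⟩ := exists_lipschitz_cubeInv (k := k) d α hk hK
  have hlim : Tendsto (fun t : ℝ => K * (C * t) ^ α + K * (C * t)) (𝓝 0) (𝓝 0) := by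
    have hc : Continuous fun t : ℝ => K * (C * t) ^ α + K * (C * t) := by
      have : Continuous fun t : ℝ => (C * t) ^ α :=
        (continuous_const.mul continuous_id).rpow_const fun _ => Or.inr hα.le
      fun_prop
    simpa [Real.zero_rpow hα.ne'] using hc.tendsto 0
  obtain ⟨δ, hδ, h⟩ := Metric.eventually_nhds_iff.1 (hlim.eventually (gt_mem_nhds hε))
  refine ⟨δ, hδ, fun φ hφ x hx y hy hxy => ?_⟩
  refine (generator_norm_fderivWithin_sub_le hφ hk hα hK (cubeInv_mem hφ hx)
    (cubeInv_mem hφ hy)).trans_lt (lt_of_le_of_lt ?_ (h (y := dist x y) (by simpa using hxy)))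
  have := hC φ hφ x hx y hy
  gcongr

end Inverse

/-! ### The law of a generator -/

section Law

variable {d k : ℕ} {α K : ℝ} {φ φ' : E d → E d}

lemma genDensity_eq_pullback (hφ : φ ∈ generators d k α K) (hk : 1 ≤ k) (hK : 0 < K) {y : E d}
    (hy : y ∈ cube d) : genDensity φ y = |(pullbackFDeriv φ y).det|⁻¹ := genDensity_eq hφ hk hK hy

lemma genDensity_pos (hφ : φ ∈ generators d k α K) (hk : 1 ≤ k) (hK : 0 < K) {y : E d}
    (hy : y ∈ cube d) : 0 < genDensity φ y := by
  rw [genDensity_eq_pullback hφ hk hK hy]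
  have := det_ne_zero_of_mem_jacobians hK (pullbackFDeriv_mem hφ hk hK hy)
  positivity

lemma genDensity_continuousOn (hφ : φ ∈ generators d k α K) (hk : 1 ≤ k) (hK : 0 < K) :
    ContinuousOn (genDensity φ) (cube d) := by
  refine ContinuousOn.congr (f := fun y => |(pullbackFDeriv φ y).det|⁻¹) ?_
    fun y hy => genDensity_eq_pullback hφ hk hK hy
  refine ContinuousOn.inv₀ (ContinuousLinearMap.continuous_det.abs.comp_continuousOn
    (pullbackFDeriv_continuousOn hφ hk)) fun y hy => ?_
  exact abs_ne_zero.2 (det_ne_zero_of_mem_jacobians hK (pullbackFDeriv_mem hφ hk hK hy))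

lemma aemeasurable_cubeMeasure_of_continuousOn {F : Type*} [TopologicalSpace F] [MeasurableSpace F]
    [BorelSpace F] {f : E d → F} (hf : ContinuousOn f (cube d)) :
    AEMeasurable f (cubeMeasure d) := hf.aemeasurable measurableSet_cube

/-- Change of variables for the inverse map: it sends `A ∩ Ω` onto `φ⁻¹(A) ∩ Ω`. -/
lemma genMeasure_eq (hφ : φ ∈ generators d k α K) (hk : 1 ≤ k) (hK : 0 < K) :
    genMeasure φ = (cubeMeasure d).withDensity fun y => ENNReal.ofReal (genDensity φ y) := by
  ext A hA
  rw [genMeasure, Measure.map_apply_of_aemeasurable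
    (aemeasurable_cubeMeasure_of_continuousOn (generator_continuousOn hφ)) hA,
        withDensity_apply _ hA,
    cubeMeasure, Measure.restrict_restrict hA,
    Measure.restrict_apply₀' measurableSet_cube.nullMeasurableSet]
  have h := lintegral_abs_det_fderiv_eq_addHaar_image volume (hA.inter measurableSet_cube)
    (fun x hx => ((cubeInv_differentiableOn hφ hk hK x hx.2).hasFDerivWithinAt.mono
      Set.inter_subset_right)) ((cubeInv_bijOn hφ).injOn.mono Set.inter_subset_right)
  refine Eq.trans ?_ h.symm
  congr 1
  ext x
  constructor
  · rintro ⟨h1, h2⟩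
    exact ⟨φ x, ⟨h1, hφ.2.1.mapsTo h2⟩, cubeInv_apply hφ h2⟩
  · rintro ⟨y, ⟨h1, h2⟩, rfl⟩
    exact ⟨by simpa [apply_cubeInv hφ h2] using h1, cubeInv_mem hφ h2⟩

end Law

/-! ### The Rosenblatt transformation of a positive continuous density -/

section Rosenblatt

variable {d : ℕ} {f : E d → ℝ}

/-- The density `f`, extended by `0` outside of the cube, as a function on `ℝᵈ`. -/
def extDensity (f : E d → ℝ) (z : Fin d → ℝ) : ℝ≥0∞ :=
  ENNReal.ofReal ((cube d).indicator f (WithLp.toLp 2 z))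

/-- The coordinates from the index `m` on. -/
abbrev coordsFrom (d m : ℕ) : Finset (Fin d) := Finset.univ.filter fun i : Fin d => m ≤ i.val

/-- The marginal density of the first `m` coordinates, with values in `[0, ∞]`. -/
def marginal (f : E d → ℝ) (m : ℕ) (y : Fin d → ℝ) : ℝ≥0∞ :=
  lmarginal (fun _ : Fin d => (volume : Measure ℝ)) (coordsFrom d m) (extDensity f) y

lemma marginalDensity_eq (f : E d → ℝ) (m : ℕ) (y : Fin d → ℝ) :
    marginalDensity f m y = (marginal f m y).toReal := rfl

lemma measurable_extDensity (hf : ContinuousOn f (cube d)) : Measurable (extDensity f) := by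
  classical
  have : Measurable ((cube d).indicator f) := by
    rw [← Set.piecewise_eq_indicator]
    exact hf.measurable_piecewise continuousOn_const measurableSet_cube
  exact (this.comp (WithLp.measurable_toLp 2 _)).ennreal_ofReal

lemma extDensity_of_mem {z : Fin d → ℝ} (hz : ∀ i, z i ∈ Set.Icc (0 : ℝ) 1) :
    extDensity f z = ENNReal.ofReal (f (WithLp.toLp 2 z)) := by
  rw [extDensity, Set.indicator_of_mem]
  exact hz

lemma extDensity_of_notMem {z : Fin d → ℝ} {i : Fin d} (hz : z i ∉ Set.Icc (0 : ℝ) 1) :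
    extDensity f z = 0 := by
  rw [extDensity, Set.indicator_of_notMem, ENNReal.ofReal_zero]
  exact fun h => hz (h i)

lemma measurable_marginal (hf : ContinuousOn f (cube d)) (m : ℕ) : Measurable (marginal f m) :=
  (measurable_extDensity hf).lmarginal _

lemma marginal_congr {m : ℕ} {y y' : Fin d → ℝ} (h : ∀ i : Fin d, i.val < m → y i = y' i) :
    marginal f m y = marginal f m y' :=
  lmarginal_congr _ _ fun i hi => h i (by simpa using hi)

lemma marginal_last (y : Fin d → ℝ) : marginal f d y = extDensity f y := by
  have : coordsFrom d d = ∅ := by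
    ext i; simp
  rw [marginal, this, lmarginal_empty]

lemma marginal_zero (f : E d → ℝ) (y : Fin d → ℝ) :
    marginal f 0 y = ∫⁻ x, ENNReal.ofReal (f x) ∂cubeMeasure d := by
  have : coordsFrom d 0 = Finset.univ := by
    ext i; simp
  rw [marginal, this, lmarginal_univ, ← volume_pi, cubeMeasure,
    ← lintegral_indicator measurableSet_cube,
    ← (PiLp.volume_preserving_toLp (Fin d)).lintegral_comp_emb
      (MeasurableEquiv.toLp 2 (Fin d → ℝ)).measurableEmbedding]
  refine lintegral_congr fun z => ?_
  by_cases hz : (WithLp.toLp 2 z : E d) ∈ cube d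
  · simp [extDensity, hz]
  · simp [extDensity, hz]

/-- The unit box in the coordinates from `m` on. -/
def box (d m : ℕ) : Set (coordsFrom d m → ℝ) := Set.univ.pi fun _ => Set.Icc (0 : ℝ) 1

lemma measurableSet_box (m : ℕ) : MeasurableSet (box d m) :=
  MeasurableSet.univ_pi fun _ => measurableSet_Icc

lemma volume_box (m : ℕ) :
    (Measure.pi fun _ : coordsFrom d m => (volume : Measure ℝ)) (box d m) = 1 := by
  rw [box, Measure.pi_pi]
  simp

lemma updateFinset_mem {m : ℕ} {y : Fin d → ℝ}
    (hy : ∀ i : Fin d, i.val < m → y i ∈ Set.Icc (0 : ℝ) 1)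
    {w : coordsFrom d m → ℝ} (hw : w ∈ box d m) (i : Fin d) :
    Function.updateFinset y (coordsFrom d m) w i ∈ Set.Icc (0 : ℝ) 1 := by
  rw [Function.updateFinset]
  split_ifs with h
  · exact hw _ (Set.mem_univ _)
  · exact hy i (by simpa using h)

lemma extDensity_updateFinset_of_notMem {m : ℕ} {y : Fin d → ℝ} {w : coordsFrom d m → ℝ}
    (hw : w ∉ box d m) : extDensity f (Function.updateFinset y (coordsFrom d m) w) = 0 := by
  simp only [box, Set.mem_pi, Set.mem_univ, true_implies, not_forall] at hw
  obtain ⟨i, hi⟩ := hw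
  refine extDensity_of_notMem (i := i.1) ?_
  rw [Function.updateFinset, dif_pos i.2]
  exact hi

lemma extDensity_le {M : ℝ} (hM : ∀ x ∈ cube d, f x ≤ M) (m : ℕ) (y : Fin d → ℝ)
    (w : coordsFrom d m → ℝ) :
    extDensity f (Function.updateFinset y (coordsFrom d m) w) ≤
      (box d m).indicator (fun _ => ENNReal.ofReal M) w := by
  by_cases hw : w ∈ box d m
  · rw [Set.indicator_of_mem hw]
    by_cases h : ∀ i, Function.updateFinset y (coordsFrom d m) w i ∈ Set.Icc (0 : ℝ) 1
    · rw [extDensity_of_mem h]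
      exact ENNReal.ofReal_le_ofReal (hM _ h)
    · push Not at h
      obtain ⟨i, hi⟩ := h
      rw [extDensity_of_notMem hi]
      exact zero_le
  · rw [extDensity_updateFinset_of_notMem hw]
    exact zero_le

lemma lintegral_box_const (m : ℕ) (c : ℝ≥0∞) :
    ∫⁻ w, (box d m).indicator (fun _ => c) w
      ∂(Measure.pi fun _ : coordsFrom d m => (volume : Measure ℝ)) = c := by
  rw [lintegral_indicator_const (measurableSet_box m), volume_box, mul_one]

lemma marginal_le {M : ℝ} (hM : ∀ x ∈ cube d, f x ≤ M) (m : ℕ) (y : Fin d → ℝ) :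
    marginal f m y ≤ ENNReal.ofReal M :=
  (lintegral_mono (extDensity_le hM m y)).trans_eq (lintegral_box_const m _)

lemma le_marginal {c : ℝ} (hc : ∀ x ∈ cube d, c ≤ f x) {m : ℕ} {y : Fin d → ℝ}
    (hy : ∀ i : Fin d, i.val < m → y i ∈ Set.Icc (0 : ℝ) 1) :
    ENNReal.ofReal c ≤ marginal f m y := by
  refine (lintegral_box_const (d := d) m _).symm.trans_le (lintegral_mono fun w => ?_)
  by_cases hw : w ∈ box d m
  · rw [Set.indicator_of_mem hw, extDensity_of_mem (updateFinset_mem hy hw)]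
    exact ENNReal.ofReal_le_ofReal (hc _ (updateFinset_mem hy hw))
  · simp [hw]

lemma marginal_eq_zero {m : ℕ} {y : Fin d → ℝ} {i : Fin d} (him : i.val < m)
    (hi : y i ∉ Set.Icc (0 : ℝ) 1) : marginal f m y = 0 := by
  refine (lintegral_congr fun w => ?_).trans lintegral_zero
  refine extDensity_of_notMem (i := i) ?_
  rwa [Function.updateFinset, dif_neg (by simpa using him)]

lemma exists_bounds (hf : ContinuousOn f (cube d)) (hpos : ∀ x ∈ cube d, 0 < f x) :
    ∃ c M, 0 < c ∧ ∀ x ∈ cube d, c ≤ f x ∧ f x ≤ M := by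
  obtain ⟨x, hx, hmin⟩ := isCompact_cube.exists_isMinOn cube_nonempty hf
  obtain ⟨z, hz, hmax⟩ := isCompact_cube.exists_isMaxOn cube_nonempty hf
  exact ⟨f x, f z, hpos x hx, fun y hy => ⟨hmin hy, hmax hy⟩⟩

/-- Dominated convergence, with an upper bound of `f` on the unit box as dominating function. The
point `s` has to be interior: at `0` and `1` the extension of the positive density by zero makes the
marginal jump. -/
lemma marginal_update_continuousAt (hf : ContinuousOn f (cube d)) (hpos : ∀ x ∈ cube d, 0 < f x)
    {y : Fin d → ℝ} (hy : ∀ i, y i ∈ Set.Icc (0 : ℝ) 1) (j : Fin d) {s : ℝ}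
    (hs : s ∈ Set.Ioo (0 : ℝ) 1) :
    ContinuousAt (fun s => marginal f (j.val + 1) (Function.update y j s)) s := by
  obtain ⟨c, M, hc, hcM⟩ := exists_bounds hf hpos
  refine tendsto_lintegral_filter_of_dominated_convergence
    ((box d (j.val + 1)).indicator fun _ => ENNReal.ofReal M) ?_ ?_ ?_ ?_
  · exact Eventually.of_forall fun t =>
      (measurable_extDensity hf).comp measurable_updateFinset
  · exact Eventually.of_forall fun t => Eventually.of_forall fun w =>
      extDensity_le (fun x hx => (hcM x hx).2) _ _ w
  · rw [lintegral_box_const]; exact ENNReal.ofReal_ne_top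
  · refine Eventually.of_forall fun w => ?_
    by_cases hw : w ∈ box d (j.val + 1)
    · have hmem : ∀ t ∈ Set.Ioo (0 : ℝ) 1, ∀ i, Function.updateFinset (Function.update y j t)
          (coordsFrom d (j.val + 1)) w i ∈ Set.Icc (0 : ℝ) 1 := fun t ht =>
        updateFinset_mem (fun i _ => by
          rcases eq_or_ne i j with rfl | hij
          · simpa using Set.Ioo_subset_Icc_self ht
          · simpa [hij] using hy i) hw
      -- Near `s` the updated point stays in the cube, where the extended density is `f` itself.
      have hev : ∀ᶠ t in 𝓝 s, t ∈ Set.Ioo (0 : ℝ) 1 := Ioo_mem_nhds hs.1 hs.2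
      rw [extDensity_of_mem (hmem s hs)]
      refine Tendsto.congr' (hev.mono fun t ht => (extDensity_of_mem (hmem t ht)).symm) ?_
      refine ENNReal.tendsto_ofReal ?_
      have hcont : Continuous fun t => (WithLp.toLp 2 (Function.updateFinset (Function.update y j t)
          (coordsFrom d (j.val + 1)) w) : E d) := by
        refine (PiLp.continuous_toLp 2 _).comp (continuous_pi fun i => ?_)
        simp only [Function.updateFinset]
        split_ifs
        · exact continuous_const
        · exact (continuous_apply (A := fun _ : Fin d => ℝ) i).comp
            ((continuous_const (y := y)).update j continuous_id)
      exact (hf (WithLp.toLp 2 (Function.updateFinset (Function.update y j s)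
          (coordsFrom d (j.val + 1)) w)) (hmem s hs)).tendsto.comp
        (tendsto_nhdsWithin_iff.2 ⟨hcont.tendsto s, hev.mono fun t ht => hmem t ht⟩)
    · simp only [extDensity_updateFinset_of_notMem hw]
      exact tendsto_const_nhds

lemma condDensity_congr {j : Fin d} {y y' : Fin d → ℝ} (h : ∀ i < j, y i = y' i) (s : ℝ) :
    condDensity f j y s = condDensity f j y' s := by
  rw [condDensity, condDensity, marginalDensity_eq, marginalDensity_eq, marginalDensity_eq,
    marginalDensity_eq, marginal_congr (y := y) fun i hi => h i hi,
    marginal_congr (y := Function.update y j s) (y' := Function.update y' j s) fun i hi => ?_]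
  rcases eq_or_ne i j with rfl | hij
  · simp
  · simpa [hij] using h i (lt_of_le_of_ne (Nat.lt_succ_iff.1 hi) hij)

lemma condDensity_continuousAt (hf : ContinuousOn f (cube d)) (hpos : ∀ x ∈ cube d, 0 < f x)
    {y : Fin d → ℝ} (hy : ∀ i, y i ∈ Set.Icc (0 : ℝ) 1) (j : Fin d) {s : ℝ}
    (hs : s ∈ Set.Ioo (0 : ℝ) 1) : ContinuousAt (condDensity f j y) s := by
  obtain ⟨c, M, hc, hcM⟩ := exists_bounds hf hpos
  refine ContinuousAt.div_const ?_ _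
  exact (ENNReal.tendsto_toReal ((marginal_le (fun x hx => (hcM x hx).2) _ _).trans_lt
    ENNReal.ofReal_lt_top).ne).comp (marginal_update_continuousAt hf hpos hy j hs)

lemma measurable_condDensity (hf : ContinuousOn f (cube d)) (j : Fin d) (y : Fin d → ℝ) :
    Measurable (condDensity f j y) :=
  (((measurable_marginal hf _).comp (measurable_update y)).ennreal_toReal).div_const _

lemma integrable_condDensity (hf : ContinuousOn f (cube d)) (hpos : ∀ x ∈ cube d, 0 < f x)
    (j : Fin d) (y : Fin d → ℝ) : Integrable (condDensity f j y) := by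
  obtain ⟨c, M, hc, hcM⟩ := exists_bounds hf hpos
  have hsupp : Function.support (condDensity f j y) ⊆ Set.Icc 0 1 := by
    intro s hs
    by_contra hs'
    refine hs ?_
    rw [condDensity, marginalDensity_eq, marginal_eq_zero (i := j) (Nat.lt_succ_self _)
        (by simpa using hs')]
    simp
  rw [← integrableOn_iff_integrable_of_support_subset hsupp]
  refine Measure.integrableOn_of_bounded (M := M / marginalDensity f j.val y) (by simp)
    (measurable_condDensity hf j y).aestronglyMeasurable (Eventually.of_forall fun s => ?_)
  have h0 : 0 ≤ marginalDensity f j.val y := ENNReal.toReal_nonneg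
  obtain ⟨x, hx⟩ := cube_nonempty (d := d)
  have hM0 : 0 ≤ M := (hpos x hx).le.trans (hcM x hx).2
  rw [condDensity, norm_div, Real.norm_of_nonneg h0,
    Real.norm_of_nonneg (marginalDensity_eq f _ _ ▸ ENNReal.toReal_nonneg)]
  gcongr
  exact ENNReal.toReal_le_of_le_ofReal hM0 (marginal_le (fun x hx => (hcM x hx).2) _ _)

lemma hasDerivAt_integral_Iic {g : ℝ → ℝ} (hg : Integrable g) {b : ℝ} (hb : ContinuousAt g b) :
    HasDerivAt (fun t => ∫ s in Set.Iic t, g s) (g b) b := by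
  have h : ∀ t, ∫ s in Set.Iic t, g s = (∫ s in Set.Iic b, g s) + ∫ s in b..t, g s := fun t => by
    rw [← intervalIntegral.integral_Iic_sub_Iic hg.integrableOn hg.integrableOn]; ring
  rw [funext h]
  refine (intervalIntegral.integral_hasDerivAt_right hg.intervalIntegrable ?_ hb).const_add _
  exact hg.aestronglyMeasurable.stronglyMeasurableAtFilter

/-- Component `i` depends only on the coordinates up to `i`; this is the source of triangularity. -/
lemma rosenblatt_congr {y y' : E d} {i : Fin d} (h : ∀ j ≤ i, y j = y' j) :
    rosenblatt f y i = rosenblatt f y' i := by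
  simp only [rosenblatt, h i le_rfl]
  exact integral_congr_ae (Eventually.of_forall fun s =>
    condDensity_congr (fun j hj => h j hj.le) s)

/-- Moving `y i` leaves the conditioning coordinates fixed, so only the upper limit of the integral
changes and the fundamental theorem of calculus yields the conditional density. -/
lemma hasDerivAt_rosenblatt (hf : ContinuousOn f (cube d)) (hpos : ∀ x ∈ cube d, 0 < f x)
    {y : E d} (hy : y ∈ openCube d) (i : Fin d) :
    HasDerivAt (fun t : ℝ => rosenblatt f (y + t • EuclideanSpace.single i 1) i)
      (marginalDensity f (i.val + 1) (WithLp.ofLp y) / marginalDensity f i.val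
          (WithLp.ofLp y)) 0 := by
  have h1 : ∀ t : ℝ, rosenblatt f (y + t • EuclideanSpace.single i 1) i =
      ∫ s in Set.Iic (y i + t), condDensity f i (WithLp.ofLp y) s := by
    intro t
    simp only [rosenblatt, PiLp.add_apply, PiLp.smul_apply, PiLp.single_apply, if_true,
      smul_eq_mul, mul_one]
    refine integral_congr_ae (Eventually.of_forall fun s => condDensity_congr (fun j hj => ?_) s)
    simp [hj.ne]
  have hyc : ∀ i, WithLp.ofLp y i ∈ Set.Icc (0 : ℝ) 1 := openCube_subset_cube hy
  have h2 := hasDerivAt_integral_Iic (integrable_condDensity hf hpos i (WithLp.ofLp y))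
    (condDensity_continuousAt hf hpos hyc i (hy i))
  have h3 : HasDerivAt (fun t => ∫ s in Set.Iic (y i + t), condDensity f i (WithLp.ofLp y) s)
      (condDensity f i (WithLp.ofLp y) (y i)) 0 :=
    HasDerivAt.comp_const_add (y i) 0 (by simpa using h2)
  simp only [h1]
  convert! h3 using 1
  simp [condDensity]

/-- The product telescopes from the total mass `1` to the full density. The bounds on `f` keep all
marginals finite and nonzero. -/
lemma prod_marginalDensity_ratio (hf : ContinuousOn f (cube d)) (hpos : ∀ x ∈ cube d, 0 < f x)
    (hint : ∫⁻ x, ENNReal.ofReal (f x) ∂cubeMeasure d = 1) {y : E d} (hy : y ∈ cube d) :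
    ∏ i : Fin d, marginalDensity f (i.val + 1) (WithLp.ofLp y) /
      marginalDensity f i.val (WithLp.ofLp y) = f y := by
  obtain ⟨c, M, hc, hcM⟩ := exists_bounds hf hpos
  have hne : ∀ m, marginalDensity f m (WithLp.ofLp y) ≠ 0 := fun m => by
    refine (ENNReal.toReal_pos ?_ ?_).ne'
    · exact ((ENNReal.ofReal_pos.2 hc).trans_le
        (le_marginal (fun x hx => (hcM x hx).1) fun i _ => hy i)).ne'
    · exact ((marginal_le (fun x hx => (hcM x hx).2) m _).trans_lt ENNReal.ofReal_lt_top).ne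
  have key : ∀ n, ∏ i ∈ Finset.range n, marginalDensity f (i + 1) (WithLp.ofLp y) /
      marginalDensity f i (WithLp.ofLp y) =
      marginalDensity f n (WithLp.ofLp y) / marginalDensity f 0 (WithLp.ofLp y) := by
    intro n
    induction n with
    | zero => simp [div_self (hne 0)]
    | succ n ih =>
      rw [Finset.prod_range_succ, ih]
      have := hne n; have := hne 0
      field_simp
  rw [Fin.prod_univ_eq_prod_range (fun i => marginalDensity f (i + 1) (WithLp.ofLp y) /
      marginalDensity f i (WithLp.ofLp y)) d, key, marginalDensity_eq, marginalDensity_eq,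
    marginal_zero, hint, marginal_last, extDensity_of_mem (fun i => hy i)]
  simp [(hpos y hy).le]

/-- The matrix of `L` is lower triangular, so only its diagonal matters and the partial derivatives
below the diagonal need not be computed. Differentiability is assumed through `χ`, in the
application the differentiable inverse of a generator, so that continuity of `f` suffices here. -/
lemma det_eq_of_eventuallyEq_rosenblatt (hf : ContinuousOn f (cube d))
    (hpos : ∀ x ∈ cube d, 0 < f x)
    (hint : ∫⁻ x, ENNReal.ofReal (f x) ∂cubeMeasure d = 1) {y : E d} (hy : y ∈ openCube d)
    {χ : E d → E d} {L : E d →L[ℝ] E d} (hL : HasFDerivAt χ L y) (hχ : χ =ᶠ[𝓝 y] rosenblatt f) :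
    L.det = f y := by
  classical
  have hderiv : ∀ i j : Fin d, HasDerivAt
      (fun t : ℝ => rosenblatt f (y + t • EuclideanSpace.single j 1) i)
      (L (EuclideanSpace.single j 1) i) 0 := by
    intro i j
    have h1 : HasFDerivAt (rosenblatt f) L y := hL.congr_of_eventuallyEq hχ.symm
    have h2 := h1.hasLineDerivAt (EuclideanSpace.single j (1 : ℝ))
    exact ((EuclideanSpace.proj i : E d →L[ℝ] ℝ).hasFDerivAt).comp_hasDerivAt 0 h2
  let b := (EuclideanSpace.basisFun (Fin d) ℝ).toBasis
  have hentry : ∀ i j, LinearMap.toMatrix b b (L : E d →ₗ[ℝ] E d) i j =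
      L (EuclideanSpace.single j 1) i := by
    intro i j
    simp [b, LinearMap.toMatrix_apply]
  have htri : (LinearMap.toMatrix b b (L : E d →ₗ[ℝ] E d)).IsLowerTriangular := by
    intro i j hij
    rw [hentry]
    have hij' : i < j := hij
    refine (hderiv i j).unique ?_
    have : (fun t : ℝ => rosenblatt f (y + t • EuclideanSpace.single j 1) i) =
        fun _ => rosenblatt f y i := by
      funext t
      refine rosenblatt_congr fun l hl => ?_
      simp [(hl.trans_lt hij').ne]
    rw [this]
    exact hasDerivAt_const _ _
  have hdiag : ∀ i, LinearMap.toMatrix b b (L : E d →ₗ[ℝ] E d) i i =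
      marginalDensity f (i.val + 1) (WithLp.ofLp y) / marginalDensity f i.val (WithLp.ofLp y) := by
    intro i
    rw [hentry]
    exact (hderiv i i).unique (hasDerivAt_rosenblatt hf hpos hy i)
  rw [ContinuousLinearMap.det, ← LinearMap.det_toMatrix b, Matrix.det_of_isLowerTriangular _ htri,
    Finset.prod_congr rfl fun i _ => hdiag i,
    prod_marginalDensity_ratio hf hpos hint (openCube_subset_cube hy)]

variable {k : ℕ} {α K : ℝ}

/-- Bijectivity of the Rosenblatt map is not established; only that of `invRosenblatt f` is
available. If `x` is the preimage of `y` under `invRosenblatt f`, then either `x` is a value of the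
Rosenblatt map on the cube, and `x = rosenblatt f y`, or `invRosenblatt f x` is the default value
`y₀` of `Function.invFunOn`. Injectivity thus leaves at most one bad point `y₀`. -/
lemma exists_cubeInv_invRosenblatt_eq (hφ : invRosenblatt f ∈ generators d k α K) :
    ∃ y₀ : E d, ∀ y ∈ cube d, y ≠ y₀ → cubeInv (invRosenblatt f) y = rosenblatt f y := by
  refine ⟨Classical.choice inferInstance, fun y hy hne => ?_⟩
  have h1 := apply_cubeInv hφ hy
  by_cases h : ∃ a ∈ cube d, rosenblatt f a = cubeInv (invRosenblatt f) y
  · have h2 := Function.invFunOn_eq h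
    change rosenblatt f (invRosenblatt f (cubeInv (invRosenblatt f) y)) = _ at h2
    rw [h1] at h2
    exact h2.symm
  · refine absurd ?_ hne
    rw [← h1]
    exact Function.invFunOn_neg h

theorem genDensity_invRosenblatt (hd : 1 ≤ d) (hk : 1 ≤ k) (hK : 0 < K)
    (hf : ContinuousOn f (cube d)) (hpos : ∀ x ∈ cube d, 0 < f x)
    (hint : ∫⁻ x, ENNReal.ofReal (f x) ∂cubeMeasure d = 1)
    (hφ : invRosenblatt f ∈ generators d k α K) :
    Set.EqOn (genDensity (invRosenblatt f)) f (cube d) := by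
  refine eqOn_cube_of_ae (genDensity_continuousOn hφ hk hK) hf ?_
  obtain ⟨y₀, hy₀⟩ := exists_cubeInv_invRosenblatt_eq hφ
  -- In positive dimension the exceptional point is a null set.
  have : Nonempty (Fin d) := ⟨⟨0, hd⟩⟩
  have hne : ∀ᵐ y ∂cubeMeasure d, y ≠ y₀ := ae_restrict_of_ae (by simp [ae_iff])
  filter_upwards [ae_mem_openCube, hne] with y hy hyne
  have hdiff : HasFDerivAt (cubeInv (invRosenblatt f))
      (fderivWithin ℝ (cubeInv (invRosenblatt f)) (cube d) y) y :=
    ((cubeInv_differentiableOn hφ hk hK y (openCube_subset_cube hy)).hasFDerivWithinAt).hasFDerivAt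
      (cube_mem_nhds hy)
  have hev : cubeInv (invRosenblatt f) =ᶠ[𝓝 y] rosenblatt f := by
    filter_upwards [cube_mem_nhds hy, isOpen_ne.mem_nhds hyne] with z hz hzne using hy₀ z hz hzne
  rw [genDensity, jacobian, det_eq_of_eventuallyEq_rosenblatt hf hpos hint hy hdiff hev,
    abs_of_pos (hpos y (openCube_subset_cube hy))]

end Rosenblatt

/-! ### A uniform law of large numbers -/

section UniformLaw

variable {X : Type*} [PseudoMetricSpace X]

/-- A family of functions that is uniformly bounded and uniformly equicontinuous on `C`. -/
structure IsEquiFamily (F : Set (X → ℝ)) (C : Set X) : Prop where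
  bounded : ∃ M, ∀ g ∈ F, ∀ x ∈ C, |g x| ≤ M
  equicontinuous : ∀ ε > 0, ∃ δ > 0, ∀ g ∈ F, ∀ x ∈ C, ∀ y ∈ C, dist x y < δ → dist (g x) (g y) < ε

variable {F : Set (X → ℝ)} {C : Set X}

lemma IsEquiFamily.continuousOn (hF : IsEquiFamily F C) {g : X → ℝ} (hg : g ∈ F) :
    ContinuousOn g C := by
  rw [Metric.continuousOn_iff]
  intro x hx ε hε
  obtain ⟨δ, hδ, h⟩ := hF.equicontinuous ε hε
  exact ⟨δ, hδ, fun y hy hyx => h g hg y hy x hx hyx⟩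

/-- By Arzelà-Ascoli the restrictions to `C` are totally bounded in the uniform norm. -/
lemma IsEquiFamily.exists_finite_net (hF : IsEquiFamily F C) (hC : IsCompact C) {ε : ℝ}
    (hε : 0 < ε) :
    ∃ T : Set (X → ℝ), T ⊆ F ∧ T.Finite ∧ ∀ g ∈ F, ∃ h ∈ T, ∀ x ∈ C, |g x - h x| ≤ ε := by
  have : CompactSpace C := isCompact_iff_compactSpace.1 hC
  let A : Set (BoundedContinuousFunction C ℝ) := {b | ∃ g ∈ F, ∀ x : C, b x = g x}
  obtain ⟨M, hM⟩ := hF.bounded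
  have hA : IsCompact (closure A) := by
    refine BoundedContinuousFunction.arzela_ascoli (Set.Icc (-M) M) isCompact_Icc A ?_ ?_
    · rintro f x ⟨g, hg, hfg⟩
      rw [hfg]
      exact abs_le.1 (hM g hg x x.2)
    · refine UniformEquicontinuous.equicontinuous ?_
      rw [Metric.uniformEquicontinuous_iff]
      intro ε hε
      obtain ⟨δ, hδ, h⟩ := hF.equicontinuous ε hε
      refine ⟨δ, hδ, fun x y hxy b => ?_⟩
      obtain ⟨g, hg, hbg⟩ := b.2
      rw [hbg, hbg]
      exact h g hg x x.2 y y.2 hxy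
  -- The centres of the net are taken inside `A`, so that `r` can lift each of them back to a member
  -- of `F`.
  obtain ⟨t, htA, htf, hcov⟩ := (hA.totallyBounded.subset subset_closure).exists_subset
    (Metric.dist_mem_uniformity hε)
  choose! r hrF hr using fun b (hb : b ∈ A) => hb
  refine ⟨r '' t, ?_, htf.image r, fun g hg => ?_⟩
  · rintro _ ⟨b, hb, rfl⟩
    exact hrF b (htA hb)
  · let b : BoundedContinuousFunction C ℝ :=
      BoundedContinuousFunction.mkOfCompact ⟨C.domRestrict g, (hF.continuousOn hg).domRestrict⟩
    have hb : b ∈ A := ⟨g, hg, fun x => rfl⟩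
    obtain ⟨b', hb', hbb'⟩ := Set.mem_iUnion₂.1 (hcov hb)
    refine ⟨r b', ⟨b', hb', rfl⟩, fun x hx => ?_⟩
    have h1 : dist (b ⟨x, hx⟩) (b' ⟨x, hx⟩) < ε :=
      (BoundedContinuousFunction.dist_coe_le_dist _).trans_lt hbb'
    rw [hr b' (htA hb') ⟨x, hx⟩, Real.dist_eq] at h1
    exact h1.le

variable [MeasurableSpace X] [OpensMeasurableSpace X]

lemma integrable_of_continuousOn_of_bounded {ν : Measure X} [IsFiniteMeasure ν]
    (hC : MeasurableSet C) (hν : ∀ᵐ x ∂ν, x ∈ C) {g : X → ℝ} (hg : ContinuousOn g C) {M : ℝ}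
    (hM : ∀ x ∈ C, |g x| ≤ M) : Integrable g ν := by
  refine Integrable.of_bound (C := M) ?_ (hν.mono hM)
  rw [← Measure.restrict_eq_self_of_ae_mem hν]
  exact (hg.aemeasurable hC).aestronglyMeasurable

variable {S : Type*} [MeasurableSpace S] {P : Measure S}

lemma strong_law_of_continuousOn {ν : Measure X} [IsFiniteMeasure ν] (hC : MeasurableSet C)
    (hν : ∀ᵐ x ∂ν, x ∈ C) {ξ : ℕ → S → X} (hξ : ∀ i, HasLaw (ξ i) ν P) (hind : iIndepFun ξ P)
    {g : X → ℝ} (hg : ContinuousOn g C) {M : ℝ} (hM : ∀ x ∈ C, |g x| ≤ M) :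
    ∀ᵐ ω ∂P, Tendsto (fun n : ℕ => (∑ i ∈ Finset.range n, g (ξ i ω)) / n) atTop
      (𝓝 (∫ x, g x ∂ν)) := by
  classical
  -- Off `C` the function `g` is arbitrary; cutting it off makes it measurable and changes nothing
  -- along samples that stay in `C` almost surely.
  have hmeas : Measurable (C.indicator g) := by
    rw [← Set.piecewise_eq_indicator]
    exact hg.measurable_piecewise continuousOn_const hC
  have hae : C.indicator g =ᵐ[ν] g := hν.mono fun x hx => Set.indicator_of_mem hx g
  have hint : Integrable (C.indicator g) ν :=
    (integrable_congr hae).2 (integrable_of_continuousOn_of_bounded hC hν hg hM)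
  have hlaw := strong_law_ae_real (μ := P) (fun i => C.indicator g ∘ ξ i) ?_ ?_ ?_
  · have hmem : ∀ᵐ ω ∂P, ∀ i, ξ i ω ∈ C := ae_all_iff.2 fun i => by
      have := hν
      rw [← (hξ i).map_eq] at this
      exact ae_of_ae_map (hξ i).aemeasurable this
    filter_upwards [hlaw, hmem] with ω h1 h2
    have h3 : ∫ ω, (C.indicator g ∘ ξ 0) ω ∂P = ∫ x, g x ∂ν := by
      rw [← integral_congr_ae hae, ← (hξ 0).map_eq,
        integral_map (hξ 0).aemeasurable hmeas.aestronglyMeasurable]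
      rfl
    rw [h3] at h1
    simpa [Set.indicator_of_mem (h2 _)] using h1
  · rw [← (hξ 0).map_eq] at hint
    exact hint.comp_aemeasurable (hξ 0).aemeasurable
  · intro i j hij
    exact (hind.indepFun hij).comp hmeas hmeas
  · intro i
    exact (IdentDistrib.mk (hξ i).aemeasurable (hξ 0).aemeasurable
      ((hξ i).map_eq.trans (hξ 0).map_eq.symm)).comp hmeas

/-- The law of large numbers holds uniformly over a bounded equicontinuous family on a compact
set. -/
theorem IsEquiFamily.uniform_strong_law (hF : IsEquiFamily F C) (hC : IsCompact C)
    (hCm : MeasurableSet C) {ν : Measure X} [IsProbabilityMeasure ν] (hν : ∀ᵐ x ∂ν, x ∈ C)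
    {ξ : ℕ → S → X} (hξ : ∀ i, HasLaw (ξ i) ν P) (hind : iIndepFun ξ P) :
    ∀ᵐ ω ∂P, ∀ ε > 0, ∀ᶠ n : ℕ in atTop, ∀ g ∈ F,
      |(∑ i ∈ Finset.range n, g (ξ i ω)) / n - ∫ x, g x ∂ν| ≤ ε := by
  obtain ⟨M, hM⟩ := hF.bounded
  -- One finite net for each precision `1 / (m + 1)`: altogether countably many functions, so a
  -- single null set serves every `ε`.
  choose T hTF hTfin hT using fun m : ℕ =>
    hF.exists_finite_net hC (ε := 1 / ((m : ℝ) + 1)) (by positivity)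
  have hmem : ∀ᵐ ω ∂P, ∀ i, ξ i ω ∈ C := ae_all_iff.2 fun i => by
    have := hν
    rw [← (hξ i).map_eq] at this
    exact ae_of_ae_map (hξ i).aemeasurable this
  have hlaw : ∀ᵐ ω ∂P, ∀ m, ∀ h ∈ T m,
      Tendsto (fun n : ℕ => (∑ i ∈ Finset.range n, h (ξ i ω)) / n) atTop (𝓝 (∫ x, h x ∂ν)) :=
    ae_all_iff.2 fun m => (ae_ball_iff (hTfin m).countable).2 fun h hh =>
      strong_law_of_continuousOn hCm hν hξ hind (hF.continuousOn (hTF m hh)) (hM h (hTF m hh))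
  filter_upwards [hmem, hlaw] with ω hω hlim ε hε
  -- One third of `ε` each for replacing `g` by `h` in the sample mean, for the law of large numbers
  -- at `h`, and for replacing `h` by `g` in the integral.
  obtain ⟨m, hm⟩ := exists_nat_one_div_lt (show 0 < ε / 3 by positivity)
  have hev : ∀ᶠ n : ℕ in atTop, ∀ h ∈ T m,
      |(∑ i ∈ Finset.range n, h (ξ i ω)) / n - ∫ x, h x ∂ν| < ε / 3 :=
    (hTfin m).eventually_all.2 fun h hh =>
      ((hlim m h hh).sub_const _).abs.eventually_lt_const (by simpa using by positivity)
  filter_upwards [hev, eventually_ge_atTop 1] with n hn hn1 g hg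
  obtain ⟨h, hh, hgh⟩ := hT m g hg
  have hgi := integrable_of_continuousOn_of_bounded hCm hν (hF.continuousOn hg) (hM g hg)
  have hhi := integrable_of_continuousOn_of_bounded hCm hν (hF.continuousOn (hTF m hh))
    (hM h (hTF m hh))
  have hn0 : (0 : ℝ) < n := by exact_mod_cast hn1
  have h1 : |(∑ i ∈ Finset.range n, g (ξ i ω)) / n - (∑ i ∈ Finset.range n, h (ξ i ω)) / n| ≤
      ε / 3 := by
    rw [← sub_div, ← Finset.sum_sub_distrib, abs_div, abs_of_pos hn0, div_le_iff₀ hn0]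
    refine (Finset.abs_sum_le_sum_abs _ _).trans ?_
    refine (Finset.sum_le_card_nsmul _ _ (ε / 3) fun i _ => (hgh _ (hω i)).trans hm.le).trans ?_
    simp [mul_comm]
  have h2 : |∫ x, h x ∂ν - ∫ x, g x ∂ν| ≤ ε / 3 := by
    rw [← integral_sub hhi hgi, ← Real.norm_eq_abs]
    refine (norm_integral_le_of_norm_le_const (C := ε / 3) (hν.mono fun x hx => ?_)).trans
      (by simp)
    rw [Real.norm_eq_abs, abs_sub_comm]
    exact (hgh x hx).trans hm.le
  have h3 := (hn h hh).le
  rw [abs_le] at *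
  constructor <;> linarith [h1.1, h1.2, h2.1, h2.2, h3.1, h3.2]

end UniformLaw

/-! ### The discriminators as an equicontinuous family -/

section Discriminators

variable {d k : ℕ} {α K : ℝ} {φ φ' : E d → E d}

/-- `log (a / (a + b))` for the inverse Jacobian determinants `a`, `b` of two matrices. -/
def logRatio (p : (E d →L[ℝ] E d) × (E d →L[ℝ] E d)) : ℝ :=
  Real.log (|p.1.det|⁻¹ / (|p.1.det|⁻¹ + |p.2.det|⁻¹))

lemma logRatio_continuousOn (hK : 0 < K) :
    ContinuousOn (logRatio (d := d)) (jacobians d K ×ˢ jacobians d K) := by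
  have h1 : ∀ p ∈ jacobians d K ×ˢ jacobians d K, 0 < |p.1.det| := fun p hp =>
    abs_pos.2 (det_ne_zero_of_mem_jacobians hK hp.1)
  have h2 : ∀ p ∈ jacobians d K ×ˢ jacobians d K, 0 < |p.2.det| := fun p hp =>
    abs_pos.2 (det_ne_zero_of_mem_jacobians hK hp.2)
  have c1 : ContinuousOn (fun p : (E d →L[ℝ] E d) × (E d →L[ℝ] E d) => |p.1.det|⁻¹)
      (jacobians d K ×ˢ jacobians d K) :=
    (ContinuousLinearMap.continuous_det.comp continuous_fst).abs.continuousOn.inv₀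
      fun p hp => (h1 p hp).ne'
  have c2 : ContinuousOn (fun p : (E d →L[ℝ] E d) × (E d →L[ℝ] E d) => |p.2.det|⁻¹)
      (jacobians d K ×ˢ jacobians d K) :=
    (ContinuousLinearMap.continuous_det.comp continuous_snd).abs.continuousOn.inv₀
      fun p hp => (h2 p hp).ne'
  refine (c1.div (c1.add c2) fun p hp => ?_).log fun p hp => ?_
  · exact (add_pos (inv_pos.2 (h1 p hp)) (inv_pos.2 (h2 p hp))).ne'
  · exact (div_pos (inv_pos.2 (h1 p hp)) (add_pos (inv_pos.2 (h1 p hp)) (inv_pos.2 (h2 p hp)))).ne'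

lemma log_discriminator (hφ : φ ∈ generators d k α K) (hφ' : φ' ∈ generators d k α K) (hk : 1 ≤ k)
    (hK : 0 < K) {y : E d} (hy : y ∈ cube d) :
    Real.log (discriminator φ φ' y) = logRatio (pullbackFDeriv φ y, pullbackFDeriv φ' y) := by
  rw [discriminator, genDensity_eq_pullback hφ hk hK hy, genDensity_eq_pullback hφ' hk hK hy]
  rfl

/-- The class of discriminators is stable under `D ↦ 1 - D`, by exchanging the two generators, so
estimates for `log D` also apply to `log (1 - D)`. -/
lemma one_sub_discriminator (hφ : φ ∈ generators d k α K) (hφ' : φ' ∈ generators d k α K)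
    (hk : 1 ≤ k) (hK : 0 < K) {y : E d} (hy : y ∈ cube d) :
    1 - discriminator φ φ' y = discriminator φ' φ y := by
  have h1 := genDensity_pos hφ hk hK hy
  have h2 := genDensity_pos hφ' hk hK hy
  rw [discriminator, discriminator]
  field_simp
  ring

/-- `logRatio` is bounded and uniformly continuous on a compact set of pairs of matrices, and the
maps substituted into it are uniformly equicontinuous. -/
lemma isEquiFamily_log_discriminator (d : ℕ) (hk : 1 ≤ k) (hα : 0 < α) (hK : 0 < K) :
    IsEquiFamily {g | ∃ D ∈ discriminators d k α K, g = fun y => Real.log (D y)} (cube d) := by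
  have hcomp : IsCompact (jacobians d K ×ˢ jacobians d K) :=
    isCompact_jacobians.prod isCompact_jacobians
  constructor
  · obtain ⟨M, hM⟩ := hcomp.exists_bound_of_continuousOn (logRatio_continuousOn (d := d) hK)
    refine ⟨M, ?_⟩
    rintro _ ⟨_, ⟨φ, hφ, φ', hφ', rfl⟩, rfl⟩ y hy
    simp only [log_discriminator hφ hφ' hk hK hy]
    exact hM (pullbackFDeriv φ y, pullbackFDeriv φ' y)
      ⟨pullbackFDeriv_mem hφ hk hK hy, pullbackFDeriv_mem hφ' hk hK hy⟩
  · intro ε hε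
    obtain ⟨η, hη, h⟩ := Metric.uniformContinuousOn_iff.1
      (hcomp.uniformContinuousOn_of_continuous (logRatio_continuousOn (d := d) hK)) ε hε
    obtain ⟨δ, hδ, hδ'⟩ := pullbackFDeriv_equicontinuous d hk hα hK hη
    refine ⟨δ, hδ, ?_⟩
    rintro _ ⟨_, ⟨φ, hφ, φ', hφ', rfl⟩, rfl⟩ x hx y hy hxy
    simp only [log_discriminator hφ hφ' hk hK hy, log_discriminator hφ hφ' hk hK hx]
    refine h (pullbackFDeriv φ x, pullbackFDeriv φ' x)
      ⟨pullbackFDeriv_mem hφ hk hK hx, pullbackFDeriv_mem hφ' hk hK hx⟩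
      (pullbackFDeriv φ y, pullbackFDeriv φ' y)
          ⟨pullbackFDeriv_mem hφ hk hK hy, pullbackFDeriv_mem hφ' hk hK hy⟩ ?_
    exact max_lt (hδ' φ hφ x hx y hy hxy) (hδ' φ' hφ' x hx y hy hxy)

/-- Making the generator part of the test function leaves a sample with the fixed law `λ`, so the
law of large numbers is uniform in `φ` as well. Generators are `K`-Lipschitz, whence `δ / K`. -/
lemma isEquiFamily_log_one_sub_discriminator_comp (d : ℕ) (hk : 1 ≤ k) (hα : 0 < α) (hK : 0 < K) :
    IsEquiFamily {g | ∃ D ∈ discriminators d k α K, ∃ φ ∈ generators d k α K,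
      g = fun z => Real.log (1 - D (φ z))} (cube d) := by
  have hF := isEquiFamily_log_discriminator d hk hα hK
  constructor
  · obtain ⟨M, hM⟩ := hF.bounded
    refine ⟨M, ?_⟩
    rintro _ ⟨_, ⟨φ, hφ, φ', hφ', rfl⟩, ψ, hψ, rfl⟩ y hy
    have hψy := hψ.2.1.mapsTo hy
    simp only [one_sub_discriminator hφ hφ' hk hK hψy]
    exact hM _ ⟨_, ⟨φ', hφ', φ, hφ, rfl⟩, rfl⟩ _ hψy
  · intro ε hε
    obtain ⟨δ, hδ, h⟩ := hF.equicontinuous ε hε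
    refine ⟨δ / K, by positivity, ?_⟩
    rintro _ ⟨_, ⟨φ, hφ, φ', hφ', rfl⟩, ψ, hψ, rfl⟩ x hx y hy hxy
    have hψx := hψ.2.1.mapsTo hx
    have hψy := hψ.2.1.mapsTo hy
    simp only [one_sub_discriminator hφ hφ' hk hK hψy, one_sub_discriminator hφ hφ' hk hK hψx]
    refine h _ ⟨_, ⟨φ', hφ', φ, hφ, rfl⟩, rfl⟩ _ hψx _ hψy ?_
    refine (generator_norm_sub_le hψ hk hK hx hy).trans_lt ?_
    rw [mul_comm]
    exact (lt_div_iff₀ hK).1 hxy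

end Discriminators

/-! ### Measures with continuous positive densities on the cube -/

section Densities

variable {d : ℕ} {f g h : E d → ℝ}

instance : IsFiniteMeasure (cubeMeasure d) :=
  ⟨by rw [cubeMeasure, Measure.restrict_apply_univ]; exact isCompact_cube.measure_lt_top⟩

/-- The measure on the cube with density `f`. -/
def densityMeasure (f : E d → ℝ) : Measure (E d) :=
  (cubeMeasure d).withDensity fun x => ENNReal.ofReal (f x)

lemma densityMeasure_absolutelyContinuous (f : E d → ℝ) : densityMeasure f ≪ cubeMeasure d :=
  withDensity_absolutelyContinuous _ _

lemma ae_mem_cube_densityMeasure (f : E d → ℝ) : ∀ᵐ x ∂densityMeasure f, x ∈ cube d :=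
  (densityMeasure_absolutelyContinuous f).ae_le ae_mem_cube

lemma integrable_cubeMeasure_of_continuousOn (hf : ContinuousOn f (cube d)) :
    Integrable f (cubeMeasure d) := hf.integrableOn_compact isCompact_cube

lemma aemeasurable_ofReal_of_continuousOn (hf : ContinuousOn f (cube d)) :
    AEMeasurable (fun x => ENNReal.ofReal (f x)) (cubeMeasure d) :=
  (aemeasurable_cubeMeasure_of_continuousOn hf).ennreal_ofReal

lemma integral_densityMeasure (hf : ContinuousOn f (cube d)) (hpos : ∀ x ∈ cube d, 0 < f x)
    (h : E d → ℝ) : ∫ x, h x ∂densityMeasure f = ∫ x, f x * h x ∂cubeMeasure d := by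
  rw [densityMeasure, integral_withDensity_eq_integral_toReal_smul₀
    (aemeasurable_ofReal_of_continuousOn hf) (by simp)]
  refine integral_congr_ae (ae_mem_cube.mono fun x hx => ?_)
  simp [(hpos x hx).le]

lemma integral_eq_one_of_isProbabilityMeasure (hf : ContinuousOn f (cube d))
    (hpos : ∀ x ∈ cube d, 0 < f x) [IsProbabilityMeasure (densityMeasure f)] :
    ∫ x, f x ∂cubeMeasure d = 1 := by
  have := integral_densityMeasure hf hpos fun _ => 1
  simpa using this.symm

lemma densityMeasure_eq_withDensity (hf : ContinuousOn f (cube d)) (hh : ContinuousOn h (cube d))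
    (hhpos : ∀ x ∈ cube d, 0 < h x) :
    densityMeasure f = (densityMeasure h).withDensity fun x => ENNReal.ofReal (f x / h x) := by
  have hq : ContinuousOn (fun x => f x / h x) (cube d) := hf.div hh fun x hx => (hhpos x hx).ne'
  rw [densityMeasure, densityMeasure, ← withDensity_mul₀ (aemeasurable_ofReal_of_continuousOn hh)
    (aemeasurable_ofReal_of_continuousOn hq)]
  refine withDensity_congr_ae (ae_mem_cube.mono fun x hx => ?_)
  have h1 := hhpos x hx
  simp only [Pi.mul_apply]
  rw [← ENNReal.ofReal_mul h1.le, mul_div_cancel₀ _ h1.ne']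

lemma llr_densityMeasure (hf : ContinuousOn f (cube d)) (hh : ContinuousOn h (cube d))
    (hpos : ∀ x ∈ cube d, 0 < f x) (hhpos : ∀ x ∈ cube d, 0 < h x)
    [IsProbabilityMeasure (densityMeasure h)] :
    densityMeasure f ≪ densityMeasure h ∧
    llr (densityMeasure f) (densityMeasure h) =ᵐ[densityMeasure f]
      fun x => Real.log (f x / h x) := by
  have hq : ContinuousOn (fun x => f x / h x) (cube d) := hf.div hh fun x hx => (hhpos x hx).ne'
  have heq := densityMeasure_eq_withDensity hf hh hhpos
  have hac : densityMeasure f ≪ densityMeasure h := by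
    rw [heq]; exact withDensity_absolutelyContinuous _ _
  refine ⟨hac, ?_⟩
  have h1 := Measure.rnDeriv_withDensity₀ (densityMeasure h)
    ((aemeasurable_ofReal_of_continuousOn hq).mono_ac (densityMeasure_absolutelyContinuous h))
  rw [← heq] at h1
  filter_upwards [hac.ae_le h1, ae_mem_cube_densityMeasure f] with x hx hxc
  rw [llr, hx, ENNReal.toReal_ofReal (div_pos (hpos x hxc) (hhpos x hxc)).le]

lemma log_div_continuousOn (hf : ContinuousOn f (cube d)) (hh : ContinuousOn h (cube d))
    (hpos : ∀ x ∈ cube d, 0 < f x) (hhpos : ∀ x ∈ cube d, 0 < h x) :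
    ContinuousOn (fun x => Real.log (f x / h x)) (cube d) :=
  (hf.div hh fun x hx => (hhpos x hx).ne').log
    fun x hx => (div_pos (hpos x hx) (hhpos x hx)).ne'

lemma klDiv_densityMeasure (hf : ContinuousOn f (cube d)) (hh : ContinuousOn h (cube d))
    (hpos : ∀ x ∈ cube d, 0 < f x) (hhpos : ∀ x ∈ cube d, 0 < h x)
    [IsProbabilityMeasure (densityMeasure f)] [IsProbabilityMeasure (densityMeasure h)] :
    InformationTheory.klDiv (densityMeasure f) (densityMeasure h) ≠ ∞ ∧
    (InformationTheory.klDiv (densityMeasure f) (densityMeasure h)).toReal =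
      klDivDensity (cubeMeasure d) f h := by
  obtain ⟨hac, hllr⟩ := llr_densityMeasure hf hh hpos hhpos
  have hlog := log_div_continuousOn hf hh hpos hhpos
  constructor
  · refine InformationTheory.klDiv_ne_top hac ((integrable_congr hllr).2 ?_)
    obtain ⟨M, hM⟩ := isCompact_cube.exists_bound_of_continuousOn hlog
    exact integrable_of_continuousOn_of_bounded measurableSet_cube (ae_mem_cube_densityMeasure f)
      hlog hM
  -- Equal total masses cancel the mass correction in `klDiv`.
  · rw [InformationTheory.toReal_klDiv_of_measure_eq hac (by simp), integral_congr_ae hllr,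
      integral_densityMeasure hf hpos, klDivDensity]

lemma half_smul_add_densityMeasure (hf : ContinuousOn f (cube d))
    (hpos : ∀ x ∈ cube d, 0 < f x) (hgpos : ∀ x ∈ cube d, 0 < g x) :
    (2⁻¹ : ℝ≥0∞) • (densityMeasure f + densityMeasure g) =
      densityMeasure fun x => (f x + g x) / 2 := by
  have h1 : AEMeasurable (fun x => ENNReal.ofReal (f x)) (cubeMeasure d) :=
    aemeasurable_ofReal_of_continuousOn hf
  have hadd : densityMeasure f + densityMeasure g = (cubeMeasure d).withDensity
      fun x => ENNReal.ofReal (f x) + ENNReal.ofReal (g x) := by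
    ext A hA
    simp only [densityMeasure, Measure.add_apply, withDensity_apply _ hA]
    exact (lintegral_add_left' h1.restrict _).symm
  rw [hadd, densityMeasure, ← withDensity_smul' _ _ (by simp)]
  refine withDensity_congr_ae (ae_mem_cube.mono fun x hx => ?_)
  have := hpos x hx
  have := hgpos x hx
  simp only [Pi.smul_apply, smul_eq_mul]
  rw [← ENNReal.ofReal_add (by positivity) (by positivity), div_eq_inv_mul,
    ENNReal.ofReal_mul (by norm_num), ENNReal.ofReal_inv_of_pos (by norm_num), ENNReal.ofReal_ofNat]

lemma jsDiv_densityMeasure (hf : ContinuousOn f (cube d)) (hg : ContinuousOn g (cube d))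
    (hpos : ∀ x ∈ cube d, 0 < f x) (hgpos : ∀ x ∈ cube d, 0 < g x)
    [IsProbabilityMeasure (densityMeasure f)] [IsProbabilityMeasure (densityMeasure g)] :
    jsDiv (densityMeasure f) (densityMeasure g) =
      ENNReal.ofReal (jsDivDensity (cubeMeasure d) f g) := by
  have hm : ContinuousOn (fun x => (f x + g x) / 2) (cube d) := (hf.add hg).div_const 2
  have hmpos : ∀ x ∈ cube d, 0 < (f x + g x) / 2 := fun x hx => by
    have := hpos x hx; have := hgpos x hx; positivity
  have hhalf := half_smul_add_densityMeasure hf hpos hgpos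
  have : IsProbabilityMeasure (densityMeasure fun x => (f x + g x) / 2) := by
    rw [← hhalf]
    constructor
    simp only [Measure.smul_apply, Measure.add_apply, measure_univ, smul_eq_mul]
    rw [one_add_one_eq_two, ENNReal.inv_mul_cancel two_ne_zero ENNReal.ofNat_ne_top]
  obtain ⟨h1, h1'⟩ := klDiv_densityMeasure hf hm hpos hmpos
  obtain ⟨h2, h2'⟩ := klDiv_densityMeasure hg hm hgpos hmpos
  rw [jsDiv, hhalf, jsDivDensity, ← h1', ← h2', ← ENNReal.toReal_add h1 h2,
    ENNReal.ofReal_mul (by norm_num), ENNReal.ofReal_toReal (ENNReal.add_ne_top.2 ⟨h1, h2⟩),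
    one_div, ENNReal.ofReal_inv_of_pos (by norm_num), ENNReal.ofReal_ofNat]

/-- Bounding each logarithm by `log t ≥ 1 - 1/t` gives two lower bounds that add up to exactly `0`.
-/
lemma js_integrand_nonneg {a b : ℝ} (ha : 0 < a) (hb : 0 < b) :
    0 ≤ a * Real.log (a / ((a + b) / 2)) + b * Real.log (b / ((a + b) / 2)) := by
  have h1 := mul_le_mul_of_nonneg_left
    (Real.one_sub_inv_le_log_of_pos (show 0 < a / ((a + b) / 2) by positivity)) ha.le
  have h2 := mul_le_mul_of_nonneg_left
    (Real.one_sub_inv_le_log_of_pos (show 0 < b / ((a + b) / 2) by positivity)) hb.le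
  have h3 : a * (1 - (a / ((a + b) / 2))⁻¹) + b * (1 - (b / ((a + b) / 2))⁻¹) = 0 := by
    field_simp; ring
  linarith

/-- The logarithm bound is strict unless its argument is `1`, so strictness in the first term alone
already contradicts a zero sum. -/
lemma eq_of_js_integrand_eq_zero {a b : ℝ} (ha : 0 < a) (hb : 0 < b)
    (h : a * Real.log (a / ((a + b) / 2)) + b * Real.log (b / ((a + b) / 2)) = 0) : a = b := by
  by_contra hab
  have h1 := mul_lt_mul_of_pos_left (Real.log_lt_sub_one_of_pos
    (show 0 < (a / ((a + b) / 2))⁻¹ by positivity) (fun h => hab ?_)) ha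
  · have h2 := mul_le_mul_of_nonneg_left
      (Real.one_sub_inv_le_log_of_pos (show 0 < b / ((a + b) / 2) by positivity)) hb.le
    have h3 : a * (1 - (a / ((a + b) / 2))⁻¹) + b * (1 - (b / ((a + b) / 2))⁻¹) = 0 := by
      field_simp; ring
    rw [Real.log_inv] at h1
    linarith
  · rw [inv_eq_one, div_eq_one_iff_eq (by positivity)] at h
    linarith

lemma jsDivDensity_eq_integral (hf : ContinuousOn f (cube d)) (hg : ContinuousOn g (cube d))
    (hpos : ∀ x ∈ cube d, 0 < f x) (hgpos : ∀ x ∈ cube d, 0 < g x) :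
    jsDivDensity (cubeMeasure d) f g = 1 / 2 * ∫ x, (f x * Real.log (f x / ((f x + g x) / 2)) +
      g x * Real.log (g x / ((f x + g x) / 2))) ∂cubeMeasure d := by
  have hm : ContinuousOn (fun x => (f x + g x) / 2) (cube d) := (hf.add hg).div_const 2
  have hmpos : ∀ x ∈ cube d, 0 < (f x + g x) / 2 := fun x hx => by
    have := hpos x hx; have := hgpos x hx; positivity
  rw [jsDivDensity, klDivDensity, klDivDensity, integral_add]
  · exact integrable_cubeMeasure_of_continuousOn (hf.mul (log_div_continuousOn hf hm hpos hmpos))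
  · exact integrable_cubeMeasure_of_continuousOn (hg.mul (log_div_continuousOn hg hm hgpos hmpos))

lemma jsDivDensity_nonneg (hf : ContinuousOn f (cube d)) (hg : ContinuousOn g (cube d))
    (hpos : ∀ x ∈ cube d, 0 < f x) (hgpos : ∀ x ∈ cube d, 0 < g x) :
    0 ≤ jsDivDensity (cubeMeasure d) f g := by
  rw [jsDivDensity_eq_integral hf hg hpos hgpos]
  have := integral_nonneg_of_ae (ae_mem_cube.mono fun x hx =>
    js_integrand_nonneg (hpos x hx) (hgpos x hx))
  linarith

lemma eqOn_of_jsDivDensity_le_zero (hf : ContinuousOn f (cube d)) (hg : ContinuousOn g (cube d))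
    (hpos : ∀ x ∈ cube d, 0 < f x) (hgpos : ∀ x ∈ cube d, 0 < g x)
    (h : jsDivDensity (cubeMeasure d) f g ≤ 0) : Set.EqOn f g (cube d) := by
  have h0 := h.antisymm (jsDivDensity_nonneg hf hg hpos hgpos)
  have hm : ContinuousOn (fun x => (f x + g x) / 2) (cube d) := (hf.add hg).div_const 2
  have hmpos : ∀ x ∈ cube d, 0 < (f x + g x) / 2 := fun x hx => by
    have := hpos x hx; have := hgpos x hx; positivity
  rw [jsDivDensity_eq_integral hf hg hpos hgpos, mul_eq_zero_iff_left (by norm_num),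
    integral_eq_zero_iff_of_nonneg_ae (ae_mem_cube.mono fun x hx =>
      js_integrand_nonneg (hpos x hx) (hgpos x hx))
    (integrable_cubeMeasure_of_continuousOn ((hf.mul (log_div_continuousOn hf hm hpos hmpos)).add
      (hg.mul (log_div_continuousOn hg hm hgpos hmpos))))] at h0
  refine eqOn_cube_of_ae hf hg ?_
  filter_upwards [h0, ae_mem_cube] with x hx hxc
  exact eq_of_js_integrand_eq_zero (hpos x hxc) (hgpos x hxc) hx

/-- Used with `h` the sum of the two densities: passing from the sum to the mean costs `log 2`
because `f` has mass one, which produces the constant in the loss. -/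
lemma integral_mul_log_div_half (hf : ContinuousOn f (cube d)) (hm : ContinuousOn h (cube d))
    (hpos : ∀ x ∈ cube d, 0 < f x) (hmpos : ∀ x ∈ cube d, 0 < h x)
    (hf1 : ∫ x, f x ∂cubeMeasure d = 1) :
    klDivDensity (cubeMeasure d) f (fun x => h x / 2) =
      (∫ x, f x * Real.log (f x / h x) ∂cubeMeasure d) + Real.log 2 := by
  have h1 : ∀ᵐ x ∂cubeMeasure d, f x * Real.log (f x / (h x / 2)) =
      f x * Real.log (f x / h x) + f x * Real.log 2 := ae_mem_cube.mono fun x hx => by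
    have := hpos x hx; have := hmpos x hx
    rw [← mul_add, ← Real.log_mul (by positivity) (by norm_num)]
    congr 2
    field_simp
  rw [klDivDensity, integral_congr_ae h1, integral_add, integral_mul_const, hf1, one_mul]
  · exact integrable_cubeMeasure_of_continuousOn (hf.mul (log_div_continuousOn hf hm hpos hmpos))
  · exact (integrable_cubeMeasure_of_continuousOn hf).mul_const _

end Densities

/-! ### The losses -/

section Losses

variable {d k : ℕ} {α K : ℝ} {φ φ₀ : E d → E d} {f : E d → ℝ}

lemma genMeasure_eq_densityMeasure (hφ : φ ∈ generators d k α K) (hk : 1 ≤ k) (hK : 0 < K) :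
    genMeasure φ = densityMeasure (genDensity φ) := genMeasure_eq hφ hk hK

lemma isProbabilityMeasure_genMeasure [IsProbabilityMeasure (cubeMeasure d)]
    (hφ : φ ∈ generators d k α K) : IsProbabilityMeasure (genMeasure φ) :=
  Measure.isProbabilityMeasure_map
    (aemeasurable_cubeMeasure_of_continuousOn (generator_continuousOn hφ))

lemma discriminator_mem_Icc (φ φ' : E d → E d) (x : E d) :
    discriminator φ φ' x ∈ Set.Icc (0 : ℝ) 1 := by
  have h1 : 0 ≤ genDensity φ x := abs_nonneg _
  have h2 : 0 ≤ genDensity φ' x := abs_nonneg _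
  exact ⟨by rw [discriminator]; positivity, div_le_one_of_le₀ (by linarith) (by positivity)⟩

/-- This holds at every point, off the cube too. Both losses are therefore at most `0` for arbitrary
measures and samples, which bounds the real suprema from above. -/
lemma log_nonpos_of_mem_discriminators {D : E d → ℝ} (hD : D ∈ discriminators d k α K) (x : E d) :
    Real.log (D x) ≤ 0 ∧ Real.log (1 - D x) ≤ 0 := by
  obtain ⟨φ, -, φ', -, rfl⟩ := hD
  have h := discriminator_mem_Icc φ φ' x
  exact ⟨Real.log_nonpos h.1 h.2, Real.log_nonpos (by linarith [h.2]) (by linarith [h.1])⟩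

lemma loss_nonpos (μ : Measure (E d)) (φ : E d → E d) {D : E d → ℝ}
    (hD : D ∈ discriminators d k α K) : loss μ φ D ≤ 0 := by
  have h1 : ∫ y, Real.log (D y) ∂μ ≤ 0 :=
    integral_nonpos fun x => (log_nonpos_of_mem_discriminators hD x).1
  have h2 : ∫ y, Real.log (1 - D y) ∂genMeasure φ ≤ 0 :=
    integral_nonpos fun x => (log_nonpos_of_mem_discriminators hD x).2
  rw [loss]
  linarith

lemma empLoss_nonpos (y z : ℕ → E d) (φ : E d → E d) (n : ℕ) {D : E d → ℝ}
    (hD : D ∈ discriminators d k α K) : empLoss y z φ D n ≤ 0 := by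
  have h1 : ∑ i ∈ Finset.range n, Real.log (D (y i)) ≤ 0 :=
    Finset.sum_nonpos fun i _ => (log_nonpos_of_mem_discriminators hD _).1
  have h2 : ∑ i ∈ Finset.range n, Real.log (1 - D (φ (z i))) ≤ 0 :=
    Finset.sum_nonpos fun i _ => (log_nonpos_of_mem_discriminators hD _).2
  have h0 : (0 : ℝ) ≤ 1 / (2 * n) := by positivity
  exact add_nonpos (mul_nonpos_of_nonneg_of_nonpos h0 h1) (mul_nonpos_of_nonneg_of_nonpos h0 h2)

lemma loss_le_maxLoss (μ : Measure (E d)) (φ : E d → E d) {D : E d → ℝ}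
    (hD : D ∈ discriminators d k α K) : loss μ φ D ≤ maxLoss k α K μ φ :=
  le_ciSup (f := fun D : discriminators d k α K => loss μ φ D)
    ⟨0, by rintro _ ⟨D, rfl⟩; exact loss_nonpos μ φ D.2⟩ ⟨D, hD⟩

lemma empLoss_le_maxEmpLoss (y z : ℕ → E d) (φ : E d → E d) (n : ℕ) {D : E d → ℝ}
    (hD : D ∈ discriminators d k α K) : empLoss y z φ D n ≤ maxEmpLoss k α K y z n φ :=
  le_ciSup (f := fun D : discriminators d k α K => empLoss y z φ D n)
    ⟨0, by rintro _ ⟨D, rfl⟩; exact empLoss_nonpos y z φ n D.2⟩ ⟨D, hD⟩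

lemma discriminator_mem (hφ₀ : φ₀ ∈ generators d k α K) (hφ : φ ∈ generators d k α K) :
    discriminator φ₀ φ ∈ discriminators d k α K := ⟨φ₀, hφ₀, φ, hφ, rfl⟩

lemma discriminator_mem_Ioo (hφ₀ : φ₀ ∈ generators d k α K) (hφ : φ ∈ generators d k α K)
    (hk : 1 ≤ k) (hK : 0 < K) {x : E d} (hx : x ∈ cube d) :
    discriminator φ₀ φ x ∈ Set.Ioo (0 : ℝ) 1 := by
  have h1 := genDensity_pos hφ₀ hk hK hx
  have h2 := genDensity_pos hφ hk hK hx
  exact ⟨by rw [discriminator]; positivity, by rw [discriminator, div_lt_one] <;> linarith⟩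

lemma log_discriminator_continuousOn (hα : 0 < α) (hk : 1 ≤ k) (hK : 0 < K) {D : E d → ℝ}
    (hD : D ∈ discriminators d k α K) : ContinuousOn (fun x => Real.log (D x)) (cube d) :=
  (isEquiFamily_log_discriminator d hk hα hK).continuousOn ⟨D, hD, rfl⟩

lemma log_one_sub_discriminator_continuousOn (hα : 0 < α) (hk : 1 ≤ k) (hK : 0 < K) {D : E d → ℝ}
    (hD : D ∈ discriminators d k α K) : ContinuousOn (fun x => Real.log (1 - D x)) (cube d) := by
  obtain ⟨φ, hφ, φ', hφ', rfl⟩ := hD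
  refine (log_discriminator_continuousOn hα hk hK (discriminator_mem hφ' hφ)).congr fun x hx => ?_
  simp only [one_sub_discriminator hφ hφ' hk hK hx]

lemma loss_eq (hk : 1 ≤ k) (hK : 0 < K) (hf : ContinuousOn f (cube d))
    (hpos : ∀ x ∈ cube d, 0 < f x) (hφ : φ ∈ generators d k α K) (D : E d → ℝ) :
    loss (densityMeasure f) φ D = 1 / 2 * ((∫ x, f x * Real.log (D x) ∂cubeMeasure d) +
      ∫ x, genDensity φ x * Real.log (1 - D x) ∂cubeMeasure d) := by
  rw [loss, genMeasure_eq_densityMeasure hφ hk hK, integral_densityMeasure hf hpos,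
    integral_densityMeasure (genDensity_continuousOn hφ hk hK) fun x => genDensity_pos hφ hk hK]

/-- With equal densities both logarithms are integrated against `f`, and `log t + log (1 - t) ≤ -2
log 2` pointwise because `4 t (1 - t) ≤ 1`. -/
lemma loss_le_of_genDensity_eq (hα : 0 < α) (hk : 1 ≤ k) (hK : 0 < K)
    (hf : ContinuousOn f (cube d)) (hpos : ∀ x ∈ cube d, 0 < f x)
    (hf1 : ∫ x, f x ∂cubeMeasure d = 1) (hφ₀ : φ₀ ∈ generators d k α K)
    (heq : Set.EqOn (genDensity φ₀) f (cube d)) {D : E d → ℝ} (hD : D ∈ discriminators d k α K) :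
    loss (densityMeasure f) φ₀ D ≤ -Real.log 2 := by
  have hc1 : ContinuousOn (fun x => f x * Real.log (D x)) (cube d) :=
    hf.mul (log_discriminator_continuousOn hα hk hK hD)
  have hc2 : ContinuousOn (fun x => f x * Real.log (1 - D x)) (cube d) :=
    hf.mul (log_one_sub_discriminator_continuousOn hα hk hK hD)
  have h1 : ∫ x, genDensity φ₀ x * Real.log (1 - D x) ∂cubeMeasure d =
      ∫ x, f x * Real.log (1 - D x) ∂cubeMeasure d :=
    integral_congr_ae (ae_mem_cube.mono fun x hx => by simp only [heq hx])
  rw [loss_eq hk hK hf hpos hφ₀ D, h1, ← integral_add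
    (integrable_cubeMeasure_of_continuousOn hc1) (integrable_cubeMeasure_of_continuousOn hc2)]
  have h2 : ∫ x, (f x * Real.log (D x) + f x * Real.log (1 - D x)) ∂cubeMeasure d ≤
      ∫ x, f x * (-2 * Real.log 2) ∂cubeMeasure d := by
    refine integral_mono_ae (integrable_cubeMeasure_of_continuousOn (hc1.add hc2))
      ((integrable_cubeMeasure_of_continuousOn hf).mul_const _) (ae_mem_cube.mono fun x hx => ?_)
    obtain ⟨φ, hφ, φ', hφ', rfl⟩ := hD
    obtain ⟨h0, h1⟩ := discriminator_mem_Ioo hφ hφ' hk hK hx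
    set t := discriminator φ φ' x
    have h3 : Real.log t + Real.log (1 - t) ≤ -2 * Real.log 2 := by
      have h4 : Real.log (4 * (t * (1 - t))) ≤ 0 :=
        Real.log_nonpos (by nlinarith) (by nlinarith [sq_nonneg (2 * t - 1)])
      have h5 : Real.log 4 = 2 * Real.log 2 := by
        rw [show (4 : ℝ) = 2 ^ 2 by norm_num, Real.log_pow]; norm_num
      rw [Real.log_mul (by norm_num) (mul_pos h0 (by linarith)).ne',
        Real.log_mul h0.ne' (by linarith : 0 < 1 - t).ne'] at h4
      linarith
    calc f x * Real.log t + f x * Real.log (1 - t) = f x * (Real.log t + Real.log (1 - t)) :=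
        by ring
      _ ≤ f x * (-2 * Real.log 2) := mul_le_mul_of_nonneg_left h3 (hpos x hx).le
  rw [integral_mul_const, hf1] at h2
  linarith

/-- Since `φ₀` generates `f`, this discriminator is `f / (f + f_φ)`, the classical optimal one. Only
its value enters, as a lower bound for the maximal loss; its optimality is not needed. -/
lemma loss_discriminator_eq [IsProbabilityMeasure (cubeMeasure d)] (hk : 1 ≤ k)
    (hK : 0 < K) (hf : ContinuousOn f (cube d)) (hpos : ∀ x ∈ cube d, 0 < f x)
    (hf1 : ∫ x, f x ∂cubeMeasure d = 1) (hφ₀ : φ₀ ∈ generators d k α K)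
    (heq : Set.EqOn (genDensity φ₀) f (cube d)) (hφ : φ ∈ generators d k α K) :
    loss (densityMeasure f) φ (discriminator φ₀ φ) =
      jsDivDensity (cubeMeasure d) f (genDensity φ) - Real.log 2 := by
  have hg := genDensity_continuousOn hφ hk hK
  have hgpos : ∀ x ∈ cube d, 0 < genDensity φ x := fun x hx => genDensity_pos hφ hk hK hx
  have : IsProbabilityMeasure (densityMeasure (genDensity φ)) := by
    rw [← genMeasure_eq_densityMeasure hφ hk hK]
    exact isProbabilityMeasure_genMeasure hφ
  have hg1 := integral_eq_one_of_isProbabilityMeasure hg hgpos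
  have hs : ContinuousOn (fun x => f x + genDensity φ x) (cube d) := hf.add hg
  have hspos : ∀ x ∈ cube d, 0 < f x + genDensity φ x := fun x hx =>
    add_pos (hpos x hx) (hgpos x hx)
  rw [loss_eq hk hK hf hpos hφ, jsDivDensity,
    integral_mul_log_div_half hf hs hpos hspos hf1, integral_mul_log_div_half hg hs hgpos hspos hg1]
  have h1 : ∫ x, f x * Real.log (discriminator φ₀ φ x) ∂cubeMeasure d =
      ∫ x, f x * Real.log (f x / (f x + genDensity φ x)) ∂cubeMeasure d :=
    integral_congr_ae (ae_mem_cube.mono fun x hx => by simp only [discriminator, heq hx])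
  have h2 : ∫ x, genDensity φ x * Real.log (1 - discriminator φ₀ φ x) ∂cubeMeasure d =
      ∫ x, genDensity φ x * Real.log (genDensity φ x / (f x + genDensity φ x)) ∂cubeMeasure d :=
    integral_congr_ae (ae_mem_cube.mono fun x hx => by
      simp only [one_sub_discriminator hφ₀ hφ hk hK hx]
      rw [discriminator, heq hx, add_comm])
  rw [h1, h2]
  ring

lemma integral_genMeasure_log_one_sub (hα : 0 < α) (hk : 1 ≤ k) (hK : 0 < K)
    (hφ : φ ∈ generators d k α K) {D : E d → ℝ} (hD : D ∈ discriminators d k α K) :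
    ∫ y, Real.log (1 - D y) ∂genMeasure φ = ∫ z, Real.log (1 - D (φ z)) ∂cubeMeasure d := by
  refine integral_map (aemeasurable_cubeMeasure_of_continuousOn (generator_continuousOn hφ)) ?_
  refine AEStronglyMeasurable.mono_ac ?_
    (aemeasurable_cubeMeasure_of_continuousOn
      (log_one_sub_discriminator_continuousOn hα hk hK hD)).aestronglyMeasurable
  change genMeasure φ ≪ _
  rw [genMeasure_eq_densityMeasure hφ hk hK]
  exact densityMeasure_absolutelyContinuous _

/-- The empirical loss converges almost surely to the theoretical loss, uniformly over generators
and discriminators. -/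
theorem uniform_empLoss_sub_loss (hα : 0 < α) (hk : 1 ≤ k) (hK : 0 < K)
    {μ : Measure (E d)} [IsProbabilityMeasure μ] (hμ : ∀ᵐ x ∂μ, x ∈ cube d)
    [IsProbabilityMeasure (cubeMeasure d)]
    {S : Type*} [MeasurableSpace S] {P : Measure S} {Y Z : ℕ → S → E d}
    (hY : ∀ i, HasLaw (Y i) μ P) (hYind : iIndepFun Y P)
    (hZ : ∀ i, HasLaw (Z i) (cubeMeasure d) P) (hZind : iIndepFun Z P) :
    ∀ᵐ ω ∂P, ∀ ε > 0, ∀ᶠ n : ℕ in atTop, ∀ φ ∈ generators d k α K,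
      ∀ D ∈ discriminators d k α K,
        |empLoss (fun i => Y i ω) (fun i => Z i ω) φ D n - loss μ φ D| ≤ ε := by
  filter_upwards [(isEquiFamily_log_discriminator d hk hα hK).uniform_strong_law isCompact_cube
    measurableSet_cube hμ hY hYind,
    (isEquiFamily_log_one_sub_discriminator_comp d hk hα hK).uniform_strong_law isCompact_cube
    measurableSet_cube ae_mem_cube hZ hZind] with ω h1 h2 ε hε
  filter_upwards [h1 ε hε, h2 ε hε] with n h1 h2 φ hφ D hD
  have h3 := h1 _ ⟨D, hD, rfl⟩
  have h4 := h2 _ ⟨D, hD, φ, hφ, rfl⟩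
  rw [← integral_genMeasure_log_one_sub hα hk hK hφ hD] at h4
  -- Each sampling error has weight `1/2`, so accuracy `ε` for both suffices.
  have h5 : ∀ a b u v : ℝ, 1 / (2 * (n : ℝ)) * a + 1 / (2 * n) * b - 1 / 2 * (u + v) =
      1 / 2 * (a / n - u) + 1 / 2 * (b / n - v) := fun a b u v => by
    rw [one_div_mul_eq_div, one_div_mul_eq_div, mul_comm 2 (n : ℝ), ← div_div, ← div_div]
    ring
  rw [empLoss, loss, h5]
  rw [abs_le] at *
  constructor <;> linarith [h3.1, h3.2, h4.1, h4.2]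

end Losses
end GAN

end

/-! ### Identification of the minimizers and consistency of the empirical minimizers. -/

theorem mainTheorem5 {d k : ℕ} (hd : 1 ≤ d) (hk : 1 ≤ k) {α K : ℝ} (hα : 0 < α) (hα1 : α ≤ 1)
    (hK : 0 < K)
    -- the data distribution `μ` on the cube, with a positive `C^{k,α}` density `fμ`
    (μ : Measure (GAN.E d)) [IsProbabilityMeasure μ] (fμ : GAN.E d → ℝ)
    (hμ : μ = (GAN.cubeMeasure d).withDensity fun x => ENNReal.ofReal (fμ x))
    (hfμ : GAN.MemHolder k α fμ) (hpos : ∀ x ∈ GAN.cube d, 0 < fμ x)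
    -- `K` is so large that the inverse Rosenblatt transformation is an admissible generator
    (hφ : GAN.invRosenblatt fμ ∈ GAN.generators d k α K)
    -- the samples
    {S : Type*} [MeasurableSpace S] (P : Measure S) [IsProbabilityMeasure P]
    (Y Z : ℕ → S → GAN.E d)
    (hY : ∀ i, HasLaw (Y i) μ P) (hYind : iIndepFun Y P)
    (hZ : ∀ i, HasLaw (Z i) (GAN.cubeMeasure d) P) (hZind : iIndepFun Z P) :
    (∀ φstar ∈ GAN.generators d k α K,
      IsMinOn (GAN.maxLoss k α K μ) (GAN.generators d k α K) φstar →
        Set.EqOn (GAN.genDensity φstar) fμ (GAN.cube d)) ∧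
    ∀ᵐ ω ∂P, ∀ φhat : ℕ → GAN.E d → GAN.E d,
      (∀ n, 1 ≤ n → φhat n ∈ GAN.generators d k α K ∧
        IsMinOn (GAN.maxEmpLoss k α K (fun i => Y i ω) (fun i => Z i ω) n)
          (GAN.generators d k α K) (φhat n)) →
      Tendsto (fun n => GAN.jsDivDensity (GAN.cubeMeasure d) fμ (GAN.genDensity (φhat n)))
        atTop (𝓝 0) ∧
      Tendsto (fun n => GAN.jsDiv μ (GAN.genMeasure (φhat n))) atTop (𝓝 0) := by
  have hf : ContinuousOn fμ (GAN.cube d) := hfμ.1.continuousOn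
  -- `λ` has mass one, being the law of `Z 0`.
  have : IsProbabilityMeasure (GAN.cubeMeasure d) :=
    (hZ 0).isProbabilityMeasure_iff.1 inferInstance
  change μ = GAN.densityMeasure fμ at hμ
  subst hμ
  have hint : ∫⁻ x, ENNReal.ofReal (fμ x) ∂GAN.cubeMeasure d = 1 := by
    have := measure_univ (μ := GAN.densityMeasure fμ)
    rwa [GAN.densityMeasure, withDensity_apply _ MeasurableSet.univ, Measure.restrict_univ] at this
  have hf1 := GAN.integral_eq_one_of_isProbabilityMeasure hf hpos
  have heq := GAN.genDensity_invRosenblatt hd hk hK hf hpos hint hφ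
  have hne : Nonempty (GAN.discriminators d k α K) := ⟨⟨_, GAN.discriminator_mem hφ hφ⟩⟩
  constructor
  · intro φ hφs hmin
    have h1 : GAN.maxLoss k α K (GAN.densityMeasure fμ) (GAN.invRosenblatt fμ) ≤ -Real.log 2 :=
      ciSup_le fun D => GAN.loss_le_of_genDensity_eq hα hk hK hf hpos hf1 hφ heq D.2
    have h2 := GAN.loss_le_maxLoss (GAN.densityMeasure fμ) φ (GAN.discriminator_mem hφ hφs)
    rw [GAN.loss_discriminator_eq hk hK hf hpos hf1 hφ heq hφs] at h2
    have h3 : GAN.maxLoss k α K (GAN.densityMeasure fμ) φ ≤ _ := hmin hφ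
    exact (GAN.eqOn_of_jsDivDensity_le_zero hf (GAN.genDensity_continuousOn hφs hk hK) hpos
      (fun x hx => GAN.genDensity_pos hφs hk hK hx) (by linarith)).symm
  · filter_upwards [GAN.uniform_empLoss_sub_loss (k := k) hα hk hK
      (GAN.ae_mem_cube_densityMeasure fμ) hY hYind hZ hZind] with ω hω φhat hmin
    have hnonneg : ∀ n, 1 ≤ n →
        0 ≤ GAN.jsDivDensity (GAN.cubeMeasure d) fμ (GAN.genDensity (φhat n)) := fun n hn =>
      GAN.jsDivDensity_nonneg hf (GAN.genDensity_continuousOn (hmin n hn).1 hk hK) hpos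
        (fun x hx => GAN.genDensity_pos (hmin n hn).1 hk hK hx)
    have hlim : Tendsto (fun n => GAN.jsDivDensity (GAN.cubeMeasure d) fμ
        (GAN.genDensity (φhat n))) atTop (𝓝 0) := by
      rw [Metric.tendsto_nhds]
      intro ε hε
      -- The uniform deviation is used twice, at `φhat n` and at the inverse Rosenblatt map, for a
      -- total of `2ε/3 < ε`. At `φhat n` the discriminator varies with the sample, so pointwise
      -- convergence would not do.
      filter_upwards [hω (ε / 3) (by positivity), eventually_ge_atTop 1] with n hn hn1
      obtain ⟨hφn, hminn⟩ := hmin n hn1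
      have h1 := hn _ hφn _ (GAN.discriminator_mem hφ hφn)
      rw [GAN.loss_discriminator_eq hk hK hf hpos hf1 hφ heq hφn, abs_le] at h1
      have h2 := GAN.empLoss_le_maxEmpLoss (fun i => Y i ω) (fun i => Z i ω) (φhat n) n
        (GAN.discriminator_mem hφ hφn)
      have h3 : GAN.maxEmpLoss k α K (fun i => Y i ω) (fun i => Z i ω) n (φhat n) ≤
        GAN.maxEmpLoss k α K (fun i => Y i ω) (fun i => Z i ω) n (GAN.invRosenblatt fμ) := hminn hφ
      have h4 : GAN.maxEmpLoss k α K (fun i => Y i ω) (fun i => Z i ω) n (GAN.invRosenblatt fμ) ≤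
          -Real.log 2 + ε / 3 := ciSup_le fun D => by
        have h5 := GAN.loss_le_of_genDensity_eq hα hk hK hf hpos hf1 hφ heq D.2
        have h6 := (abs_le.1 (hn _ hφ _ D.2)).2
        linarith
      rw [Real.dist_eq, sub_zero, abs_of_nonneg (hnonneg n hn1)]
      linarith [h1.1]
    refine ⟨hlim, ?_⟩
    have hlim' := ENNReal.tendsto_ofReal hlim
    rw [ENNReal.ofReal_zero] at hlim'
    refine hlim'.congr' ?_
    -- Nothing is assumed about `φhat 0`, so the two divergences are compared only for `n ≥ 1`.
    filter_upwards [eventually_ge_atTop 1] with n hn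
    have hφn := (hmin n hn).1
    have : IsProbabilityMeasure (GAN.densityMeasure (GAN.genDensity (φhat n))) := by
      rw [← GAN.genMeasure_eq_densityMeasure hφn hk hK]
      exact GAN.isProbabilityMeasure_genMeasure hφn
    rw [GAN.genMeasure_eq_densityMeasure hφn hk hK,
      GAN.jsDiv_densityMeasure hf (GAN.genDensity_continuousOn hφn hk hK) hpos
        fun x hx => GAN.genDensity_pos hφn hk hK hx]
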